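/- A metric tree $T$ is obtained from a finite non-null tree $T_0$ by replacing each edge with a closed interval of positive length, the end points of the interval being identified with the end vertices of the edge. Its length $|T|$ is the sum of the lengths of these intervals, and $d_T(u,v)$ denotes the length of the unique path (simple curve) in $T$ between $u,v\in T$. A sequence $(r_1,\dots,r_m)$ of non-negative reals is a cover of $T$ if there exist $v_1,\dots,v_m\in T$ such that $T=\bigcup_{i=1}^m B_T(v_i,r_i)$, where $B_T(v,r)=\{u\in T : d_T(v,u)\le r\}$. Theorem. For every $\varepsilon>0$ there exists $K=K(\varepsilon)$ such that if $k\ge K$ is a natural number and $T$ is a metric tree with $|T|\le(1-\varepsilon)k^2$, then $(1,2,\dots,k)$ is a cover of $T$. -/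

import Mathlib

open scoped NNReal

/-- The combinatorial data of a metric tree: a (non-null) discrete tree together with a positive
length for each of its edges. Values of `len` outside the edge set are irrelevant. -/
structure MetricTree (V : Type*) where
  graph : SimpleGraph V
  isTree : graph.IsTree
  len : Sym2 V → ℝ
  len_pos : ∀ e ∈ graph.edgeSet, 0 < len e

namespace MetricTree

variable {V : Type*} (T : MetricTree V)

/-- The length `|T|`: the sum of the lengths of the intervals comprising `T`. -/
noncomputable def length : ℝ := ∑ᶠ e ∈ T.graph.edgeSet, T.len e

/-- The points before gluing: the vertices, and for each oriented edge `d` the points of a closed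
interval `[0, len d]`; `onEdge d t` is the point at distance `t` from the start of `d`. -/
inductive PrePoint : Type _
  | vertex (v : V) : PrePoint
  | onEdge (d : T.graph.Dart) (t : ℝ) (h0 : 0 ≤ t) (h1 : t ≤ T.len d.edge) : PrePoint

/-- The identifications: the start of an oriented edge is its first vertex, and the intervals of
the two orientations of an edge are the same interval traversed in opposite directions. -/
inductive Glue : T.PrePoint → T.PrePoint → Prop
  | start (d : T.graph.Dart) (h0 : (0 : ℝ) ≤ 0) (h1 : 0 ≤ T.len d.edge) :
      Glue (.onEdge d 0 h0 h1) (.vertex d.fst)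
  | flip (d : T.graph.Dart) (t t' : ℝ) (h0 : 0 ≤ t) (h1 : t ≤ T.len d.edge)
      (h0' : 0 ≤ t') (h1' : t' ≤ T.len d.symm.edge) (h : t + t' = T.len d.edge) :
      Glue (.onEdge d t h0 h1) (.onEdge d.symm t' h0' h1')

/-- The set of points of the metric tree: each edge of the discrete tree is replaced by a closed
interval whose ends are identified with the end vertices of the edge. -/
def Point : Type _ := Quot T.Glue

variable {T}

/-- A vertex of the discrete tree as a point of the metric tree. -/
def Point.vertex (v : V) : T.Point := Quot.mk _ (.vertex v)

/-- The point on the oriented edge `d` at distance `t` from its start. -/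
def Point.onEdge (d : T.graph.Dart) (t : ℝ) (h0 : 0 ≤ t) (h1 : t ≤ T.len d.edge) : T.Point :=
  Quot.mk _ (.onEdge d t h0 h1)

/-- `HasPath p q l`: there is a path of length `l` from `p` to `q` which is a concatenation of
finitely many intervals, each contained in an edge. -/
inductive HasPath (p : T.Point) : T.Point → ℝ → Prop
  | refl : HasPath p p 0
  | step {l : ℝ} (d : T.graph.Dart) (s t : ℝ) (hs0 : 0 ≤ s) (hs1 : s ≤ T.len d.edge)
      (ht0 : 0 ≤ t) (ht1 : t ≤ T.len d.edge) (h : HasPath p (Point.onEdge d s hs0 hs1) l) :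
      HasPath p (Point.onEdge d t ht0 ht1) (l + |s - t|)

/-- The path metric: the length of a shortest path between two points. As `T` is a tree, this is
the length of the unique simple curve between the points. -/
noncomputable def pathDist (p q : T.Point) : ℝ := sInf {l | HasPath p q l}

theorem dart_len_pos (d : T.graph.Dart) : 0 < T.len d.edge := T.len_pos _ d.edge_mem

theorem onEdge_zero (d : T.graph.Dart) :
    (Point.onEdge d 0 le_rfl (dart_len_pos d).le : T.Point) = Point.vertex d.fst :=
  Quot.sound (Glue.start d _ _)

theorem onEdge_len (d : T.graph.Dart) :
    (Point.onEdge d (T.len d.edge) (dart_len_pos d).le le_rfl : T.Point) = Point.vertex d.snd := by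
  have h : (Point.onEdge d (T.len d.edge) (dart_len_pos d).le le_rfl : T.Point) =
      Point.onEdge d.symm 0 le_rfl (dart_len_pos d.symm).le :=
    Quot.sound (Glue.flip d _ _ _ _ _ _ (by simp))
  rw [h, onEdge_zero]; rfl

theorem HasPath.nonneg {p q : T.Point} {l : ℝ} (h : HasPath p q l) : 0 ≤ l := by
  induction h with
  | refl => exact le_rfl
  | step d s t _ _ _ _ _ ih => positivity

theorem HasPath.append {p q r : T.Point} {l m : ℝ} (h : HasPath p q l) (h' : HasPath q r m) :
    HasPath p r (l + m) := by
  induction h' with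
  | refl => simpa using h
  | step d s t _ _ _ _ _ ih => rw [← add_assoc]; exact .step d s t _ _ _ _ ih

theorem HasPath.reverse {p q : T.Point} {l : ℝ} (h : HasPath p q l) : HasPath q p l := by
  induction h with
  | refl => exact .refl
  | step d s t hs0 hs1 ht0 ht1 _ ih =>
    have := (HasPath.step d t s ht0 ht1 hs0 hs1 (.refl)).append ih
    rwa [zero_add, abs_sub_comm, add_comm] at this

theorem exists_hasPath (p q : T.Point) : ∃ l, HasPath p q l := by
  have edge : ∀ (d : T.graph.Dart) (t : ℝ) (h0 : 0 ≤ t) (h1 : t ≤ T.len d.edge),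
      ∃ l, HasPath (Point.vertex d.fst) (Point.onEdge d t h0 h1) l := fun d t h0 h1 =>
    ⟨_, .step d 0 t le_rfl (dart_len_pos d).le h0 h1 (by rw [onEdge_zero]; exact .refl)⟩
  have vert : ∀ {u v : V}, T.graph.Walk u v →
      ∃ l, HasPath (T := T) (Point.vertex u) (Point.vertex v) l := by
    intro u v w
    induction w with
    | nil => exact ⟨_, .refl⟩
    | cons h _ ih =>
      obtain ⟨l, hl⟩ := ih
      obtain ⟨m, hm⟩ := edge ⟨(_, _), h⟩ _ (dart_len_pos _).le le_rfl
      rw [onEdge_len] at hm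
      exact ⟨_, hm.append hl⟩
  have toVertex : ∀ p : T.Point, ∃ v l, HasPath (Point.vertex v) p l := by
    rintro ⟨v | ⟨d, t, h0, h1⟩⟩
    · exact ⟨v, _, .refl⟩
    · exact ⟨_, edge d t h0 h1⟩
  obtain ⟨u, l, hl⟩ := toVertex p
  obtain ⟨v, m, hm⟩ := toVertex q
  obtain ⟨w⟩ := T.isTree.connected.preconnected u v
  obtain ⟨n, hn⟩ := vert w
  exact ⟨_, (hl.reverse.append hn).append hm⟩

theorem pathDist_le {p q : T.Point} {l : ℝ} (h : HasPath p q l) : pathDist p q ≤ l :=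
  csInf_le ⟨0, fun _ h => HasPath.nonneg h⟩ h

/-- A function on the points before gluing that respects the identifications and is 1-Lipschitz on
each edge is 1-Lipschitz for the path metric. -/
theorem sub_le_pathDist (f : T.PrePoint → ℝ) (hf : ∀ a b, T.Glue a b → f a = f b)
    (hl : ∀ (d : T.graph.Dart) (s t : ℝ) (hs0 : 0 ≤ s) (hs1 : s ≤ T.len d.edge)
      (ht0 : 0 ≤ t) (ht1 : t ≤ T.len d.edge),
      f (.onEdge d t ht0 ht1) - f (.onEdge d s hs0 hs1) ≤ |s - t|) (p q : T.Point) :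
    Quot.lift f hf q - Quot.lift f hf p ≤ pathDist p q := by
  refine le_csInf (exists_hasPath p q) fun l h => ?_
  induction h with
  | refl => simp
  | step d s t hs0 hs1 ht0 ht1 _ ih =>
    have := hl d s t hs0 hs1 ht0 ht1
    change f (.onEdge d s hs0 hs1) - _ ≤ _ at ih
    change f (.onEdge d t ht0 ht1) - _ ≤ _
    linarith

theorem exists_le_len [Finite V] : ∃ m : ℝ, 0 < m ∧ ∀ d : T.graph.Dart, m ≤ T.len d.edge := by
  have := Fintype.ofFinite V
  classical
  cases isEmpty_or_nonempty T.graph.Dart with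
  | inl h => exact ⟨1, one_pos, fun d => h.elim d⟩
  | inr h =>
    obtain ⟨d, hd⟩ := Finite.exists_min fun d : T.graph.Dart => T.len d.edge
    exact ⟨_, dart_len_pos d, hd⟩

open Classical in
theorem eq_of_pathDist_vertex [Finite V] (v : V) (q : T.Point)
    (h : pathDist (Point.vertex v) q = 0) : Point.vertex v = q := by
  obtain ⟨m, hm, hmin⟩ := exists_le_len (T := T)
  let f : T.PrePoint → ℝ
    | .vertex w => if w = v then 0 else m
    | .onEdge d t _ _ =>
      if d.fst = v then min t m else if d.snd = v then min (T.len d.edge - t) m else m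
  have hf : ∀ a b, T.Glue a b → f a = f b := by
    rintro _ _ (⟨d, _, _⟩ | ⟨d, t, t', _, _, _, _, e⟩)
    · have := hmin d
      simp only [f]
      split_ifs <;> simp_all [hm.le]
    · have hne := d.fst_ne_snd
      have e1 : T.len d.edge - t = t' := by linarith
      have e2 : T.len d.edge - t' = t := by linarith
      simp only [f, SimpleGraph.Dart.edge_symm, e1, e2,
        SimpleGraph.Dart.symm_toProd, Prod.fst_swap, Prod.snd_swap]
      split_ifs with h1 h2 <;> first | rfl | exact absurd (h1.trans h2.symm) hne
  have key := sub_le_pathDist f hf (by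
    intro d s t _ _ _ _
    simp only [f]
    split_ifs
    · rw [abs_sub_comm]
      exact (le_abs_self _).trans ((abs_min_sub_min_le_max _ _ _ _).trans (by simp))
    · refine (le_abs_self _).trans ((abs_min_sub_min_le_max _ _ _ _).trans ?_)
      simp
    · simp) (Point.vertex v) q
  rw [h] at key
  rcases q with ⟨w | ⟨d, t, h0, h1⟩⟩
  · by_contra hne
    have : w ≠ v := by rintro rfl; exact hne rfl
    have : m - 0 ≤ 0 := by simpa [f, Point.vertex, this] using key
    linarith
  · have key' : f (.onEdge d t h0 h1) ≤ 0 := by simpa [f, Point.vertex] using key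
    simp only [f] at key'
    split_ifs at key' with h2 h3
    · have ht : t = 0 := by rcases min_le_iff.1 key' with h | h <;> linarith
      subst ht h2
      exact (onEdge_zero d).symm
    · have ht : t = T.len d.edge := by rcases min_le_iff.1 key' with h | h <;> linarith
      subst ht h3
      exact (onEdge_len d).symm
    · linarith

open Classical in
theorem eq_of_pathDist_onEdge (d : T.graph.Dart) (s : ℝ) (h0 : 0 < s) (h1 : s < T.len d.edge)
    (q : T.Point) (h : pathDist (Point.onEdge d s h0.le h1.le) q = 0) :
    Point.onEdge d s h0.le h1.le = q := by
  obtain ⟨m, hm, hm0, hm1⟩ : ∃ m : ℝ, 0 < m ∧ m ≤ s ∧ m ≤ T.len d.edge - s :=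
    ⟨_, lt_min h0 (sub_pos.2 h1), min_le_left _ _, min_le_right _ _⟩
  let f : T.PrePoint → ℝ
    | .vertex _ => m
    | .onEdge d' t _ _ =>
      if d' = d then min |s - t| m
      else if d' = d.symm then min |s - (T.len d.edge - t)| m else m
  have hf : ∀ a b, T.Glue a b → f a = f b := by
    rintro _ _ (⟨d', _, _⟩ | ⟨d', t, t', _, _, _, _, e⟩)
    · simp only [f]
      split_ifs
      · rw [min_eq_right]; rw [sub_zero, abs_of_pos h0]; exact hm0
      · rw [min_eq_right]; rw [sub_zero, abs_sub_comm, abs_of_pos (by linarith)]; exact hm1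
      · rfl
    · simp only [f]
      by_cases c1 : d' = d
      · subst c1
        rw [if_pos rfl, if_neg (SimpleGraph.Dart.symm_ne d'), if_pos rfl, ← e]
        simp
      · by_cases c2 : d' = d.symm
        · subst c2
          rw [if_neg c1, if_pos rfl, SimpleGraph.Dart.symm_symm, if_pos rfl]
          rw [SimpleGraph.Dart.edge_symm] at e
          rw [← e]; simp
        · rw [if_neg c1, if_neg c2, if_neg, if_neg]
          · exact fun h => c1 (SimpleGraph.Dart.symm_involutive.injective h)
          · rintro rfl; simp at c2
  have key := sub_le_pathDist f hf (by
    intro d' a b _ _ _ _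
    simp only [f]
    split_ifs
    · refine (le_abs_self _).trans ((abs_min_sub_min_le_max _ _ _ _).trans (max_le ?_ (by simp)))
      refine (abs_abs_sub_abs_le _ _).trans (le_of_eq ?_)
      congr 1; ring
    · refine (le_abs_self _).trans ((abs_min_sub_min_le_max _ _ _ _).trans (max_le ?_ (by simp)))
      refine (abs_abs_sub_abs_le _ _).trans (le_of_eq ?_)
      rw [abs_sub_comm a b]; congr 1; ring
    · simp) (Point.onEdge d s h0.le h1.le) q
  rw [h] at key
  have hs : f (.onEdge d s h0.le h1.le) = 0 := by simp [f, hm.le]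
  change _ - f (.onEdge d s h0.le h1.le) ≤ 0 at key
  rw [hs, sub_zero] at key
  rcases q with ⟨w | ⟨d', t, k0, k1⟩⟩
  · exact absurd (show m ≤ 0 from key) (not_le.2 hm)
  · change f (.onEdge d' t k0 k1) ≤ 0 at key
    simp only [f] at key
    split_ifs at key with c1 c2
    · subst c1
      have : |s - t| ≤ 0 := by rcases min_le_iff.1 key with h | h <;> linarith
      have : s = t := by linarith [abs_nonpos_iff.1 this]
      subst this; rfl
    · subst c2
      have : |s - (T.len d.edge - t)| ≤ 0 := by rcases min_le_iff.1 key with h | h <;> linarith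
      exact Quot.sound (Glue.flip d s t _ _ _ _ (by linarith [abs_nonpos_iff.1 this]))
    · linarith

noncomputable instance [Finite V] : MetricSpace T.Point where
  dist := pathDist
  dist_self p := le_antisymm (pathDist_le (.refl))
    (le_csInf (exists_hasPath p p) fun _ h => HasPath.nonneg h)
  dist_comm p q := congrArg sInf (Set.ext fun _ => ⟨HasPath.reverse, HasPath.reverse⟩)
  dist_triangle p q r := by
    rw [pathDist, pathDist, pathDist]
    refine le_of_forall_pos_le_add fun δ hδ => ?_
    obtain ⟨l, hl, hl'⟩ := Real.lt_sInf_add_pos (exists_hasPath p q) (half_pos hδ)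
    obtain ⟨m, hm, hm'⟩ := Real.lt_sInf_add_pos (exists_hasPath q r) (half_pos hδ)
    have := pathDist_le (HasPath.append hl hm)
    rw [pathDist] at this
    change l < sInf {l | HasPath p q l} + δ / 2 at hl'
    change m < sInf {l | HasPath q r l} + δ / 2 at hm'
    linarith
  eq_of_dist_eq_zero := by
    rintro ⟨v | ⟨d, s, h0, h1⟩⟩ q h
    · exact eq_of_pathDist_vertex v q h
    · rcases h0.eq_or_lt with rfl | h0'
      · change Point.onEdge d 0 h0 h1 = q
        change pathDist (Point.onEdge d 0 h0 h1) q = 0 at h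
        rw [onEdge_zero] at h ⊢
        exact eq_of_pathDist_vertex _ q h
      rcases h1.eq_or_lt with rfl | h1'
      · change Point.onEdge d (T.len d.edge) h0 h1 = q
        change pathDist (Point.onEdge d (T.len d.edge) h0 h1) q = 0 at h
        rw [onEdge_len] at h ⊢
        exact eq_of_pathDist_vertex _ q h
      · exact eq_of_pathDist_onEdge d s h0' h1' q h

variable (T)

/-- A sequence `(r₁, …, rₘ)` of non-negative reals is a cover of `T` if `T` is the union of
closed balls of these radii around some points of `T`. -/
def IsCover [Finite V] {m : ℕ} (r : Fin m → ℝ≥0) : Prop :=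
  ∃ v : Fin m → T.Point, ⋃ i, Metric.closedBall (v i) (r i) = Set.univ

end MetricTree

/-! Fix a large `m` depending only on ε and put h = ⌊k/(m+1)⌋. Points whose distance from a root
lies in a translate of hℕ turn the metric tree into a discrete one with n ≈ |T|/h nodes
(`MetricTree.exists_levelTree`). A discrete ball of radius j becomes a metric ball of radius (j+1)h,
and h of the available radii are just above this value. So it suffices to cover a discrete tree by
balls of radii 0, …, m-1, each radius used about n/m² times (`LevelTree.exists_cover`), since n/m² ≈
|T|/(hm²) is at most about (1-ε)h.

The even use of radii comes from multiplicative weights (`exists_cover_exp`): a radius is priced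
exponentially in its use so far. For arbitrary prices w of total (1-ε)m² one needs to cut off a set
of nodes that can be covered at a price at most its size, unless the whole remainder fits into one
ball (`exists_step`). A larger ball may replace a smaller one, so w may be taken monotone.

Choose x minimising ∑_{i<x} w i - x². Then the radii below x are cheap on average and w (x-1) ≤
2x-1. If no path has more than 2x-4 edges, one ball suffices. Otherwise cut below a deepest node u
that is the top of a longer path. A branch with at least 2x nodes pays for a single ball of radius
x-1; if there is none, the two deepest branches form a `Bough`: a long path with small trees hanging
from it.

A bough has x-1 covers, whose average price is at most its size (`Bough.exists_cover`). Each splits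
the path into two or three intervals, one ball per interval, and gives separate balls to the hanging
subtrees that interfere with a split. Splits occur at distinct odd positions, so by parity each
hanging node is paid for at most once in the whole family. Few hanging nodes have large height, so
Chebyshev's sum inequality bounds their total price by the mean price times their number. -/

/-! ### Rooted trees by levels, and subtrees with short paths -/

/-- A finite rooted tree, given by its parent function and the distance of a node from the root. -/
structure LevelTree (N : Type*) where
  par : N → N
  lev : N → ℕ
  lev_par : ∀ v, lev (par v) = lev v - 1
  eq_of_lev : ∀ v w, lev v = 0 → lev w = 0 → v = w

namespace LevelTree

variable {N : Type*} (F : LevelTree N)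

theorem lev_iterate (k : ℕ) (v : N) : F.lev (F.par^[k] v) = F.lev v - k := by
  induction k with
  | zero => simp
  | succ k ih => rw [Function.iterate_succ_apply', F.lev_par, ih]; omega

theorem par_eq_self {v : N} (h : F.lev v = 0) : F.par v = v :=
  F.eq_of_lev _ _ (by rw [F.lev_par, h]) h

/-- `y` lies in the ball of radius `r` around `c` of the tree. -/
def Covers (c : N) (r : ℕ) (y : N) : Prop := ∃ i j, i + j ≤ r ∧ F.par^[i] c = F.par^[j] y

/-- `y` is a descendant of `v`. -/
def Desc (v y : N) : Prop := ∃ k, F.lev y = F.lev v + k ∧ F.par^[k] y = v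

variable {F}

theorem Covers.mono {c : N} {r s : ℕ} {y : N} (h : F.Covers c r y) (hrs : r ≤ s) :
    F.Covers c s y := by
  obtain ⟨i, j, h1, h2⟩ := h
  exact ⟨i, j, h1.trans hrs, h2⟩

theorem Desc.refl (v : N) : F.Desc v v := ⟨0, rfl, rfl⟩

theorem Desc.lev_le {v y : N} (h : F.Desc v y) : F.lev v ≤ F.lev y := by
  obtain ⟨k, h, -⟩ := h; omega

theorem Desc.iterate {v y : N} (h : F.Desc v y) : F.par^[F.lev y - F.lev v] y = v := by
  obtain ⟨k, h, h'⟩ := h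
  rwa [h, Nat.add_sub_cancel_left]

theorem Desc.trans {u v y : N} (h : F.Desc u v) (h' : F.Desc v y) : F.Desc u y := by
  obtain ⟨k, h1, h2⟩ := h
  obtain ⟨l, h3, h4⟩ := h'
  exact ⟨k + l, by omega, by rw [Function.iterate_add_apply, h4, h2]⟩

theorem desc_iterate {k : ℕ} {y : N} (h : k ≤ F.lev y) : F.Desc (F.par^[k] y) y :=
  ⟨k, by rw [F.lev_iterate]; omega, rfl⟩

theorem desc_par (y : N) : F.Desc (F.par y) y := by
  rcases Nat.eq_zero_or_pos (F.lev y) with h | h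
  · rw [F.par_eq_self h]; exact .refl _
  · exact desc_iterate (k := 1) h

theorem Desc.par_of_ne {v y : N} (h : F.Desc v y) (hne : y ≠ v) : F.Desc v (F.par y) := by
  obtain ⟨k, h1, h2⟩ := h
  cases k with
  | zero => exact absurd h2 hne
  | succ k => exact ⟨k, by rw [F.lev_par]; omega, h2⟩

theorem Desc.desc_of_lev_le {u v y : N} (hu : F.Desc u y) (hv : F.Desc v y)
    (h : F.lev u ≤ F.lev v) : F.Desc u v := by
  obtain ⟨k, h1, h2⟩ := hu
  obtain ⟨l, h3, h4⟩ := hv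
  refine ⟨k - l, by omega, ?_⟩
  rw [← h4, ← Function.iterate_add_apply, Nat.sub_add_cancel (by omega), h2]

theorem Desc.eq_of_lev_eq {u v y : N} (hu : F.Desc u y) (hv : F.Desc v y)
    (h : F.lev u = F.lev v) : u = v := by
  obtain ⟨k, h1, h2⟩ := hu
  obtain ⟨l, h3, h4⟩ := hv
  obtain rfl : k = l := by omega
  rw [← h2, h4]

variable (F)

/-- Every path of `S` whose highest node is `v` has at most `K` edges. -/
def Good (K : ℕ) (S : Finset N) (v : N) : Prop :=
  ∀ y₁ ∈ S, ∀ y₂ ∈ S, ∀ k₁ k₂, F.lev y₁ = F.lev v + k₁ → F.par^[k₁] y₁ = v →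
    F.lev y₂ = F.lev v + k₂ → F.par^[k₂] y₂ = v →
    (k₁ = 0 ∨ k₂ = 0 ∨ F.par^[k₁ - 1] y₁ ≠ F.par^[k₂ - 1] y₂) → k₁ + k₂ ≤ K

/-- The distance from `y` to the path from `z` to its ancestor `n` levels up. -/
noncomputable def offset (z : N) (n : ℕ) (y : N) : ℕ :=
  sInf {a | ∃ b ≤ n, F.par^[b] z = F.par^[a] y}

/-- The number of steps from `z` to the node where the ancestors of `y` enter the path above `z`. -/
noncomputable def foot (z : N) (n : ℕ) (y : N) : ℕ :=
  F.lev z - (F.lev y - F.offset z n y)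

variable {F}

section chain

variable {c z y : N} {n : ℕ} (hz : F.lev z = F.lev c + n) (hc : F.par^[n] z = c)
  (hy : F.Desc c y)
include hz hc hy

omit hz in
theorem offset_spec : F.offset z n y ≤ F.lev y - F.lev c ∧
    ∃ b ≤ n, F.par^[b] z = F.par^[F.offset z n y] y := by
  have h1 : F.lev y - F.lev c ∈ {a | ∃ b ≤ n, F.par^[b] z = F.par^[a] y} :=
    ⟨n, le_rfl, by rw [hc, hy.iterate]⟩
  exact ⟨Nat.sInf_le h1, Nat.sInf_mem ⟨_, h1⟩⟩

theorem foot_spec : F.foot z n y ≤ n ∧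
    F.par^[F.foot z n y] z = F.par^[F.offset z n y] y ∧
    F.lev z = F.foot z n y + (F.lev y - F.offset z n y) ∧ F.offset z n y + F.lev c ≤ F.lev y := by
  obtain ⟨h1, b, hb, h2⟩ := offset_spec hc hy
  have h3 := congrArg F.lev h2
  rw [F.lev_iterate, F.lev_iterate] at h3
  have h4 := hy.lev_le
  have h5 : F.foot z n y = b := by unfold foot; omega
  rw [h5]
  exact ⟨hb, h2, by omega, by omega⟩

/-- The two numbers are the depths of `y` and `z` below the node where `y` joins the path. -/
theorem offset_le_foot (h : F.lev y ≤ F.lev z) : F.offset z n y ≤ F.foot z n y := by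
  have := foot_spec hz hc hy
  omega

/-- Going from `y` up to the path and down to `z` is a simple path: minimality of the offset makes
the two sides leave their top through different children. -/
theorem offset_add_foot_le {K : ℕ} {S : Finset N} (hzS : z ∈ S) (hyS : y ∈ S)
    (hgood : F.Good K S (F.par^[F.foot z n y] z)) : F.offset z n y + F.foot z n y ≤ K := by
  obtain ⟨h1, h2, h3, h4⟩ := foot_spec hz hc hy
  refine hgood y hyS z hzS _ _ ?_ h2.symm ?_ rfl ?_
  · rw [h2, F.lev_iterate]; omega
  · rw [F.lev_iterate]; omega
  · by_contra! hcon
    obtain ⟨h5, h6, h7⟩ := hcon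
    have : F.offset z n y ≤ F.offset z n y - 1 := Nat.sInf_le ⟨_, by omega, h7.symm⟩
    omega

theorem offset_par (h : 1 ≤ F.offset z n y) : F.Desc c (F.par y) ∧
    F.offset z n (F.par y) + 1 = F.offset z n y ∧ F.foot z n (F.par y) = F.foot z n y := by
  have hne : y ≠ c := by
    rintro rfl
    have := offset_spec hc hy
    omega
  have hd := hy.par_of_ne hne
  have h1 := offset_spec hc hy
  have h2 := offset_spec hc hd
  have h3 : F.offset z n y ≤ F.offset z n (F.par y) + 1 := by
    obtain ⟨b, hb, h⟩ := h2.2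
    exact Nat.sInf_le ⟨b, hb, h⟩
  have h4 : F.offset z n (F.par y) ≤ F.offset z n y - 1 := by
    obtain ⟨b, hb, h'⟩ := h1.2
    refine Nat.sInf_le ⟨b, hb, ?_⟩
    rw [h', ← Function.iterate_succ_apply, Nat.succ_eq_add_one, Nat.sub_add_cancel h]
  have h5 := foot_spec hz hc hy
  have h6 := foot_spec hz hc hd
  have h7 := F.lev_par y
  refine ⟨hd, by omega, by omega⟩

omit hz hy in
theorem offset_child (hy : F.Desc c (F.par y)) (h : 1 ≤ F.offset z n (F.par y)) :
    1 ≤ F.offset z n y := by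
  have hd : F.Desc c y := hy.trans (desc_par y)
  by_contra hcon
  obtain ⟨b, hb, h1⟩ := (offset_spec hc hd).2
  rw [show F.offset z n y = 0 by omega] at h1
  have h0 : F.offset z n (F.par y) ≤ 0 := by
    rcases hb.lt_or_eq with hb | hb
    · exact Nat.sInf_le ⟨b + 1, hb, by rw [Function.iterate_succ_apply', h1]; rfl⟩
    · have h2 : y = c := by rw [← hc, ← hb]; exact h1.symm
      have h3 := hy.lev_le
      rw [F.lev_par, ← h2] at h3
      refine Nat.sInf_le ⟨b, hb.le, ?_⟩
      rw [h1]
      exact (F.par_eq_self (v := y) (by omega)).symm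
  omega

/-- A subtree all of whose paths are short lies in one ball. -/
theorem covers_of_good {x : ℕ} {S : Finset N} (hzS : z ∈ S) (hyS : y ∈ S) (hyz : F.lev y ≤ F.lev z)
    (hx : 2 ≤ x) (hgood : F.Good (2 * x - 4) S (F.par^[F.foot z n y] z)) :
    F.Covers (F.par^[min (x - 1) n] z) (x - 1) y := by
  obtain ⟨h1, h2, h3, h4⟩ := foot_spec hz hc hy
  have h5 := offset_le_foot hz hc hy hyz
  have h6 := offset_add_foot_le hz hc hy hzS hyS hgood
  rcases le_total (F.foot z n y) (min (x - 1) n) with h | h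
  · refine ⟨0, min (x - 1) n - F.foot z n y + F.offset z n y, by omega, ?_⟩
    rw [Function.iterate_add_apply, ← h2, ← Function.iterate_add_apply F.par _ (F.foot z n y),
      Nat.sub_add_cancel h]
    rfl
  · refine ⟨F.foot z n y - min (x - 1) n, F.offset z n y, by omega, ?_⟩
    rw [← Function.iterate_add_apply, Nat.sub_add_cancel h, h2]

end chain

end LevelTree

/-! ### Heights, and cutting off a bough -/

namespace LevelTree

variable {N : Type*} {F : LevelTree N}

open Classical in
/-- The height of the part of the subtree below `y` that lies in `S`. -/
noncomputable def ht (F : LevelTree N) (S : Finset N) (y : N) : ℕ :=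
  (S.filter (F.Desc y)).sup fun z => F.lev z - F.lev y

theorem le_ht {S : Finset N} {y z : N} (hz : z ∈ S) (h : F.Desc y z) :
    F.lev z - F.lev y ≤ F.ht S y := by
  classical
  exact Finset.le_sup (f := fun z => F.lev z - F.lev y) (Finset.mem_filter.2 ⟨hz, h⟩)

theorem covers_ht {S : Finset N} {y z : N} (hz : z ∈ S) (h : F.Desc y z) :
    F.Covers y (F.ht S y) z :=
  ⟨0, F.lev z - F.lev y, by simpa using le_ht hz h, h.iterate.symm⟩

theorem exists_ht_eq {S : Finset N} {y : N} (hy : y ∈ S) :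
    ∃ z ∈ S, F.Desc y z ∧ F.lev z - F.lev y = F.ht S y := by
  classical
  obtain ⟨z, hz, h⟩ := Finset.exists_mem_eq_sup (S.filter (F.Desc y))
    ⟨y, Finset.mem_filter.2 ⟨hy, .refl y⟩⟩ fun z => F.lev z - F.lev y
  rw [Finset.mem_filter] at hz
  exact ⟨z, hz.1, hz.2, h.symm⟩

section chain

variable {c z y : N} {n : ℕ} (hz : F.lev z = F.lev c + n) (hc : F.par^[n] z = c)
  (hy : F.Desc c y)
include hz hc hy

/-- Once off the path, descendants never return to it, so each level down adds one to the offset. -/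
theorem offset_desc (h : 1 ≤ F.offset z n y) (k : ℕ) : ∀ w, F.lev w = F.lev y + k →
    F.par^[k] w = y → F.offset z n w = F.offset z n y + k := by
  induction k with
  | zero => intro w _ hw; rw [show w = y from hw]; rfl
  | succ k ih =>
    intro w hw1 hw2
    have h1 : F.lev (F.par w) = F.lev y + k := by rw [F.lev_par]; omega
    have h2 := ih (F.par w) h1 hw2
    have h3 : F.Desc c (F.par w) := hy.trans ⟨k, h1, hw2⟩
    have h4 := offset_child hc h3 (by omega)
    have h5 := (offset_par hz hc (h3.trans (desc_par w)) h4).2.1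
    omega

/-- A deepest descendant of `y` has offset at most its foot, and the two sum to at most 2x-4; its
offset exceeds the height of `y`. -/
theorem ht_lt_of_good {x : ℕ} {S : Finset N} (hzS : z ∈ S) (hyS : y ∈ S) (hx : 2 ≤ x)
    (hdeep : ∀ w ∈ S, F.Desc c w → F.lev w ≤ F.lev z)
    (hgood : ∀ b ≤ n, F.Good (2 * x - 4) S (F.par^[b] z))
    (h : 1 ≤ F.offset z n y) : F.ht S y < x := by
  obtain ⟨w, hw, hd, he⟩ := exists_ht_eq (F := F) hyS
  obtain ⟨k, h1, h2⟩ := hd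
  have h3 := offset_desc hz hc hy h k w h1 h2
  have h4 : F.Desc c w := hy.trans ⟨k, h1, h2⟩
  have h5 := offset_le_foot hz hc h4 (hdeep w hw h4)
  have h6 := offset_add_foot_le hz hc h4 hzS hw (hgood _ (foot_spec hz hc h4).1)
  omega

end chain

/-- A set `T` of nodes that can be cut off from `S`: a path `P 0, …, P (L - 1)` without its highest
node, together with the subtrees hanging from it. The node `y` hangs at distance `A y` from the
node `P (B y)` of the path. -/
structure Bough (F : LevelTree N) (S : Finset N) (x : ℕ) where
  T : Finset N
  L : ℕ
  P : ℕ → N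
  A : N → ℕ
  B : N → ℕ
  sub : T ⊆ S
  down : ∀ y ∈ S, F.par y ∈ T → y ∈ T
  path : ∀ b < L, ∀ g < L, ∃ i j, i + j ≤ (b - g) + (g - b) ∧ F.par^[i] (P g) = F.par^[j] (P b)
  join : ∀ y ∈ T, F.par^[A y] y = P (B y)
  A_le : ∀ y ∈ T, A y ≤ B y
  A_add_lt : ∀ y ∈ T, A y + B y < L
  A_le_lev : ∀ y ∈ T, A y ≤ F.lev y
  par_mem : ∀ y ∈ T, 1 ≤ A y → F.par y ∈ T ∧ A (F.par y) + 1 = A y ∧ B (F.par y) = B y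
  child : ∀ y ∈ S, F.par y ∈ T → 1 ≤ A (F.par y) → 1 ≤ A y
  ht_lt : ∀ y ∈ T, 1 ≤ A y → F.ht S y < x
  le_card : L ≤ (T.filter fun y => A y = 0).card + 1
  le_L : 2 * x ≤ L + 2
  L_le : L + 5 ≤ 4 * x

-- Below a deepest bad node `u` everything is good, so each branch has paths of at most 2x-4 edges
-- and fits into one ball. The two deepest branches together contain the legs of a path with at
-- least 2x-3 edges through `u`. The node `u` itself stays behind, which keeps the remainder a tree.
open Classical in
theorem exists_bough {S : Finset N} (hS : ∀ v ∈ S, F.par v ∈ S) {x : ℕ} (hx : 3 ≤ x) {u : N}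
    (huS : u ∈ S) (hu : ¬ F.Good (2 * x - 4) S u)
    (hmax : ∀ v ∈ S, F.lev u < F.lev v → F.Good (2 * x - 4) S v) :
    (∃ T ⊆ S, (∀ y ∈ S, F.par y ∈ T → y ∈ T) ∧ 2 * x ≤ T.card ∧
      ∃ c, ∀ y ∈ T, F.Covers c (x - 1) y) ∨ ∃ b : Bough F S x, b.T.card < 4 * x := by
  have hSi : ∀ k, ∀ v ∈ S, F.par^[k] v ∈ S := fun k => by
    induction k with
    | zero => exact fun v hv => hv
    | succ k ih => exact fun v hv => ih _ (hS v hv)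
  obtain ⟨z₁, hz₁, hdeep₁⟩ := Finset.exists_max_image (S.filter (F.Desc u)) F.lev
    ⟨u, Finset.mem_filter.2 ⟨huS, .refl u⟩⟩
  rw [Finset.mem_filter] at hz₁
  obtain ⟨hz₁S, a₁, hl₁, hp₁⟩ := hz₁
  have hdeep₁ : ∀ y ∈ S, F.Desc u y → F.lev y ≤ F.lev z₁ := fun y hy hd =>
    hdeep₁ y (Finset.mem_filter.2 ⟨hy, hd⟩)
  unfold Good at hu
  push Not at hu
  obtain ⟨y₁, hy₁, y₂, hy₂, k₁, k₂, e₁, f₁, e₂, f₂, hne, hk⟩ := hu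
  have ha₁ : 1 ≤ a₁ := by
    have := hdeep₁ y₁ hy₁ ⟨k₁, e₁, f₁⟩
    have := hdeep₁ y₂ hy₂ ⟨k₂, e₂, f₂⟩
    omega
  obtain ⟨c₁, hc₁⟩ : ∃ c, c = F.par^[a₁ - 1] z₁ := ⟨_, rfl⟩
  have hcl₁ : F.lev c₁ = F.lev u + 1 := by rw [hc₁, F.lev_iterate]; omega
  have hn₁ : F.lev z₁ = F.lev c₁ + (a₁ - 1) := by omega
  have hcu₁ : F.par c₁ = u := by
    rw [hc₁, ← Function.iterate_succ_apply' F.par, Nat.succ_eq_add_one, Nat.sub_add_cancel ha₁, hp₁]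
  have hud₁ : F.Desc u c₁ := ⟨1, hcl₁, hcu₁⟩
  -- The deepest node outside the first branch. If `S` has only one branch at `u`, this is `u`
  -- itself and `a₂ = 0`; hence the guards `1 ≤ a₂` below.
  obtain ⟨z₂, hz₂, hdeep₂⟩ := Finset.exists_max_image
    (S.filter fun y => F.Desc u y ∧ ¬ F.Desc c₁ y) F.lev
    ⟨u, Finset.mem_filter.2 ⟨huS, .refl u, fun h => by have := h.lev_le; omega⟩⟩
  rw [Finset.mem_filter] at hz₂
  obtain ⟨hz₂S, ⟨a₂, hl₂, hp₂⟩, hnz₂⟩ := hz₂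
  have hdeep₂ : ∀ y ∈ S, F.Desc u y → ¬ F.Desc c₁ y → F.lev y ≤ F.lev z₂ := fun y hy hd hd' =>
    hdeep₂ y (Finset.mem_filter.2 ⟨hy, hd, hd'⟩)
  obtain ⟨c₂, hc₂⟩ : ∃ c, c = F.par^[a₂ - 1] z₂ := ⟨_, rfl⟩
  -- The legs of the long path cannot both lie in the branch of `c₁`, so one is bounded by `a₂` and
  -- the other by `a₁`.
  have hsum : 2 * x ≤ a₁ + a₂ + 3 := by
    have d₁ := hdeep₁ y₁ hy₁ ⟨k₁, e₁, f₁⟩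
    have d₂ := hdeep₁ y₂ hy₂ ⟨k₂, e₂, f₂⟩
    by_cases g₁ : F.Desc c₁ y₁
    · by_cases g₂ : F.Desc c₁ y₂
      · exfalso
        have i₁ := g₁.iterate
        have i₂ := g₂.iterate
        have := g₁.lev_le
        have := g₂.lev_le
        rw [show F.lev y₁ - F.lev c₁ = k₁ - 1 by omega] at i₁
        rw [show F.lev y₂ - F.lev c₁ = k₂ - 1 by omega] at i₂
        rcases hne with h | h | h
        · omega
        · omega
        · exact h (i₁.trans i₂.symm)
      · have := hdeep₂ y₂ hy₂ ⟨k₂, e₂, f₂⟩ g₂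
        omega
    · have := hdeep₂ y₁ hy₁ ⟨k₁, e₁, f₁⟩ g₁
      omega
  have hg₁ : ∀ b ≤ a₁ - 1, F.Good (2 * x - 4) S (F.par^[b] z₁) := fun b hb =>
    hmax _ (hSi _ _ hz₁S) (by rw [F.lev_iterate]; omega)
  have hda₁ : ∀ w ∈ S, F.Desc c₁ w → F.lev w ≤ F.lev z₁ := fun w hw hd =>
    hdeep₁ w hw (hud₁.trans hd)
  have hcz₁ : F.Desc c₁ z₁ := ⟨a₁ - 1, hn₁, hc₁.symm⟩
  have hL₁ : a₁ - 1 ≤ 2 * x - 4 := by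
    have := hmax c₁ (hc₁ ▸ hSi _ _ hz₁S) (by omega) z₁ hz₁S c₁ (hc₁ ▸ hSi _ _ hz₁S) (a₁ - 1) 0
      hn₁ hc₁.symm rfl rfl (Or.inr (Or.inl rfl))
    omega
  by_cases hbig₁ : 2 * x ≤ (S.filter (F.Desc c₁)).card
  · refine Or.inl ⟨S.filter (F.Desc c₁), Finset.filter_subset _ _, ?_, hbig₁,
      F.par^[min (x - 1) (a₁ - 1)] z₁, ?_⟩
    · intro y hy hpy
      rw [Finset.mem_filter] at hpy ⊢
      exact ⟨hy, hpy.2.trans (desc_par y)⟩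
    · intro y hy
      rw [Finset.mem_filter] at hy
      exact covers_of_good hn₁ hc₁.symm hy.2 hz₁S hy.1 (hda₁ y hy.1 hy.2) (by omega)
        (hg₁ _ (foot_spec hn₁ hc₁.symm hy.2).1)
  have key₂ : 1 ≤ a₂ → F.lev c₂ = F.lev u + 1 ∧ F.lev z₂ = F.lev c₂ + (a₂ - 1) ∧ F.par c₂ = u := by
    intro h
    have : F.lev c₂ = F.lev u + 1 := by rw [hc₂, F.lev_iterate]; omega
    refine ⟨this, by omega, ?_⟩
    rw [hc₂, ← Function.iterate_succ_apply' F.par, Nat.succ_eq_add_one, Nat.sub_add_cancel h, hp₂]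
  have hg₂ : 1 ≤ a₂ → ∀ b ≤ a₂ - 1, F.Good (2 * x - 4) S (F.par^[b] z₂) := fun h b hb =>
    hmax _ (hSi _ _ hz₂S) (by rw [F.lev_iterate]; omega)
  have hdisj : 1 ≤ a₂ → ∀ w, F.Desc c₂ w → ¬ F.Desc c₁ w := fun h w hw hw' => by
    obtain ⟨h1, h2, h3⟩ := key₂ h
    have h4 : c₁ = c₂ := hw'.eq_of_lev_eq hw (by omega)
    exact hnz₂ ⟨a₂ - 1, by omega, by rw [h4, hc₂]⟩
  have hda₂ : 1 ≤ a₂ → ∀ w ∈ S, F.Desc c₂ w → F.lev w ≤ F.lev z₂ := fun h w hw hd => by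
    obtain ⟨h1, h2, h3⟩ := key₂ h
    exact hdeep₂ w hw (.trans ⟨1, h1, h3⟩ hd) (hdisj h w hd)
  have hL₂ : 1 ≤ a₂ → a₂ - 1 ≤ 2 * x - 4 := fun h => by
    have := hmax c₂ (hc₂ ▸ hSi _ _ hz₂S) (by have := key₂ h; omega) z₂ hz₂S c₂
      (hc₂ ▸ hSi _ _ hz₂S) (a₂ - 1) 0
      (key₂ h).2.1 hc₂.symm rfl rfl (Or.inr (Or.inl rfl))
    omega
  by_cases hbig₂ : 1 ≤ a₂ ∧ 2 * x ≤ (S.filter (F.Desc c₂)).card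
  · obtain ⟨h, hbig₂⟩ := hbig₂
    refine Or.inl ⟨S.filter (F.Desc c₂), Finset.filter_subset _ _, ?_, hbig₂,
      F.par^[min (x - 1) (a₂ - 1)] z₂, ?_⟩
    · intro y hy hpy
      rw [Finset.mem_filter] at hpy ⊢
      exact ⟨hy, hpy.2.trans (desc_par y)⟩
    · intro y hy
      rw [Finset.mem_filter] at hy
      exact covers_of_good (key₂ h).2.1 hc₂.symm hy.2 hz₂S hy.1 (hda₂ h y hy.1 hy.2) (by omega)
        (hg₂ h _ (foot_spec (key₂ h).2.1 hc₂.symm hy.2).1)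
  right
  have hTmem : ∀ {y}, y ∈ S.filter (F.Desc c₁) ∪ S.filter (fun y => 1 ≤ a₂ ∧ F.Desc c₂ y) ↔
      y ∈ S ∧ (F.Desc c₁ y ∨ (¬ F.Desc c₁ y ∧ 1 ≤ a₂ ∧ F.Desc c₂ y)) := by
    intro y
    rw [Finset.mem_union, Finset.mem_filter, Finset.mem_filter]
    constructor
    · rintro (h | h)
      · exact ⟨h.1, .inl h.2⟩
      · exact ⟨h.1, .inr ⟨hdisj h.2.1 y h.2.2, h.2⟩⟩
    · rintro ⟨h, h' | h'⟩
      · exact .inl ⟨h, h'⟩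
      · exact .inr ⟨h, h'.2⟩
  -- At `b = a₁` both descriptions of the path give `u`.
  have hP : ∀ b, a₁ ≤ b → (if b ≤ a₁ then F.par^[b] z₁ else F.par^[a₁ + a₂ - b] z₂) =
      F.par^[a₁ + a₂ - b] z₂ := by
    intro b hb
    split_ifs with h
    · obtain rfl : b = a₁ := le_antisymm h hb
      rw [hp₁, Nat.add_sub_cancel_left, hp₂]
    · rfl
  have hpath : ∀ b g, b ≤ g → g < a₁ + a₂ + 1 → ∃ i j, i + j ≤ g - b ∧
      F.par^[i] (if g ≤ a₁ then F.par^[g] z₁ else F.par^[a₁ + a₂ - g] z₂) =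
      F.par^[j] (if b ≤ a₁ then F.par^[b] z₁ else F.par^[a₁ + a₂ - b] z₂) := by
    intro b g hbg hg
    rcases le_total a₁ b with h | h
    · rw [hP b h, hP g (h.trans hbg)]
      refine ⟨g - b, 0, by omega, ?_⟩
      rw [← Function.iterate_add_apply, show g - b + (a₁ + a₂ - g) = a₁ + a₂ - b by omega]
      rfl
    · rw [if_pos h]
      rcases le_total a₁ g with h' | h'
      · rw [hP g h']
        refine ⟨g - a₁, a₁ - b, by omega, ?_⟩
        rw [← Function.iterate_add_apply, ← Function.iterate_add_apply,
          show g - a₁ + (a₁ + a₂ - g) = a₂ by omega, Nat.sub_add_cancel h, hp₁, hp₂]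
      · rw [if_pos h']
        refine ⟨0, g - b, by omega, ?_⟩
        rw [← Function.iterate_add_apply F.par (g - b), Nat.sub_add_cancel hbg]
        rfl
  have spec₁ : ∀ y ∈ S, F.Desc c₁ y → F.offset z₁ (a₁ - 1) y ≤ F.foot z₁ (a₁ - 1) y ∧
      F.offset z₁ (a₁ - 1) y + F.foot z₁ (a₁ - 1) y ≤ 2 * x - 4 := fun y hy hd =>
    ⟨offset_le_foot hn₁ hc₁.symm hd (hda₁ y hy hd),
      offset_add_foot_le hn₁ hc₁.symm hd hz₁S hy (hg₁ _ (foot_spec hn₁ hc₁.symm hd).1)⟩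
  have spec₂ : ∀ y ∈ S, 1 ≤ a₂ → F.Desc c₂ y → F.offset z₂ (a₂ - 1) y ≤ F.foot z₂ (a₂ - 1) y ∧
      F.offset z₂ (a₂ - 1) y + F.foot z₂ (a₂ - 1) y ≤ 2 * x - 4 := fun y hy h hd =>
    ⟨offset_le_foot (key₂ h).2.1 hc₂.symm hd (hda₂ h y hy hd),
      offset_add_foot_le (key₂ h).2.1 hc₂.symm hd hz₂S hy
        (hg₂ h _ (foot_spec (key₂ h).2.1 hc₂.symm hd).1)⟩
  refine ⟨{
    T := S.filter (F.Desc c₁) ∪ S.filter (fun y => 1 ≤ a₂ ∧ F.Desc c₂ y)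
    L := a₁ + a₂ + 1
    P := fun b => if b ≤ a₁ then F.par^[b] z₁ else F.par^[a₁ + a₂ - b] z₂
    A := fun y => if F.Desc c₁ y then F.offset z₁ (a₁ - 1) y else F.offset z₂ (a₂ - 1) y
    B := fun y => if F.Desc c₁ y then F.foot z₁ (a₁ - 1) y
      else a₁ + a₂ - F.foot z₂ (a₂ - 1) y
    sub := fun y hy => (hTmem.1 hy).1
    down := ?_, path := ?_, join := ?_, A_le := ?_, A_add_lt := ?_, A_le_lev := ?_
    par_mem := ?_, child := ?_, ht_lt := ?_, le_card := ?_, le_L := by omega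
    L_le := by omega }, ?_⟩
  · intro y hy hpy
    rw [hTmem] at hpy ⊢
    refine ⟨hy, ?_⟩
    rcases hpy.2 with h | ⟨-, h, h'⟩
    · exact .inl (h.trans (desc_par y))
    · have := h'.trans (desc_par y)
      exact .inr ⟨hdisj h y this, h, this⟩
  · intro b hb g hg
    rcases le_total b g with h | h
    · obtain ⟨i, j, h1, h2⟩ := hpath b g h hg
      exact ⟨i, j, by omega, h2⟩
    · obtain ⟨i, j, h1, h2⟩ := hpath g b h hb
      exact ⟨j, i, by omega, h2.symm⟩
  · intro y hy
    obtain ⟨hyS, h | ⟨hn, h, hd⟩⟩ := hTmem.1 hy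
    · have := foot_spec hn₁ hc₁.symm h
      simp only [if_pos h]
      rw [if_pos (by omega), this.2.1]
    · have := foot_spec (key₂ h).2.1 hc₂.symm hd
      simp only [if_neg hn]
      rw [hP _ (by omega), Nat.sub_sub_self (by omega), this.2.1]
  · intro y hy
    obtain ⟨hyS, h | ⟨hn, h, hd⟩⟩ := hTmem.1 hy
    · simp only [if_pos h]
      exact (spec₁ y hyS h).1
    · simp only [if_neg hn]
      have := foot_spec (key₂ h).2.1 hc₂.symm hd
      have := spec₂ y hyS h hd
      omega
  · intro y hy
    obtain ⟨hyS, h | ⟨hn, h, hd⟩⟩ := hTmem.1 hy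
    · simp only [if_pos h]
      have := spec₁ y hyS h
      omega
    · simp only [if_neg hn]
      have := foot_spec (key₂ h).2.1 hc₂.symm hd
      have := spec₂ y hyS h hd
      omega
  · intro y hy
    obtain ⟨hyS, h | ⟨hn, h, hd⟩⟩ := hTmem.1 hy
    · simp only [if_pos h]
      have := foot_spec hn₁ hc₁.symm h
      omega
    · simp only [if_neg hn]
      have := foot_spec (key₂ h).2.1 hc₂.symm hd
      omega
  · intro y hy hA
    obtain ⟨hyS, h | ⟨hn, h, hd⟩⟩ := hTmem.1 hy
    · simp only [if_pos h] at hA ⊢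
      obtain ⟨h1, h2, h3⟩ := offset_par hn₁ hc₁.symm h hA
      simp only [if_pos h1]
      exact ⟨hTmem.2 ⟨hS y hyS, .inl h1⟩, h2, h3⟩
    · simp only [if_neg hn] at hA ⊢
      obtain ⟨h1, h2, h3⟩ := offset_par (key₂ h).2.1 hc₂.symm hd hA
      have hn' := hdisj h _ h1
      simp only [if_neg hn']
      exact ⟨hTmem.2 ⟨hS y hyS, .inr ⟨hn', h, h1⟩⟩, h2, by rw [h3]⟩
  · intro y hyS hpy hA
    obtain ⟨-, h | ⟨hn, h, hd⟩⟩ := hTmem.1 hpy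
    · simp only [if_pos h] at hA
      simp only [if_pos (h.trans (desc_par y))]
      exact offset_child hc₁.symm h hA
    · simp only [if_neg hn] at hA
      simp only [if_neg (hdisj h _ (hd.trans (desc_par y)))]
      exact offset_child hc₂.symm hd hA
  · intro y hy hA
    obtain ⟨hyS, h | ⟨hn, h, hd⟩⟩ := hTmem.1 hy
    · simp only [if_pos h] at hA
      exact ht_lt_of_good hn₁ hc₁.symm h hz₁S hyS (by omega) hda₁ hg₁ hA
    · simp only [if_neg hn] at hA
      exact ht_lt_of_good (key₂ h).2.1 hc₂.symm hd hz₂S hyS (by omega) (hda₂ h) (hg₂ h) hA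
  · have hm₁ : ∀ t < a₁, F.Desc c₁ (F.par^[t] z₁) := fun t ht => by
      refine Desc.desc_of_lev_le hcz₁ (desc_iterate (by omega)) ?_
      rw [F.lev_iterate]; omega
    have hm₂ : ∀ t < a₂, F.Desc c₂ (F.par^[t] z₂) := fun t ht => by
      obtain ⟨h1, h2, h3⟩ := key₂ (by omega)
      refine Desc.desc_of_lev_le ⟨a₂ - 1, h2, hc₂.symm⟩ (desc_iterate (by omega)) ?_
      rw [F.lev_iterate]; omega
    rw [Nat.add_le_add_iff_right, ← Finset.card_range (a₁ + a₂)]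
    -- The `a₁ + a₂` path nodes other than `u` are listed upwards from `z₁`, then upwards from `z₂`.
    refine Finset.card_le_card_of_injOn
      (fun t => if t < a₁ then F.par^[t] z₁ else F.par^[t - a₁] z₂) ?_ ?_
    · intro t ht
      have ht : t < a₁ + a₂ := by simpa using ht
      simp only [Finset.coe_filter, Set.mem_ofPred_eq]
      by_cases h : t < a₁
      · simp only [if_pos h, if_pos (hm₁ t h)]
        exact ⟨hTmem.2 ⟨hSi _ _ hz₁S, .inl (hm₁ t h)⟩,
          Nat.le_zero.1 (Nat.sInf_le ⟨t, by omega, rfl⟩)⟩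
      · have hd := hm₂ (t - a₁) (by omega)
        have hn := hdisj (by omega) _ hd
        simp only [if_neg h, if_neg hn]
        exact ⟨hTmem.2 ⟨hSi _ _ hz₂S, .inr ⟨hn, by omega, hd⟩⟩,
          Nat.le_zero.1 (Nat.sInf_le ⟨t - a₁, by omega, rfl⟩)⟩
    · intro s hs t ht hst
      have hs : s < a₁ + a₂ := by simpa using hs
      have ht : t < a₁ + a₂ := by simpa using ht
      simp only at hst
      split_ifs at hst with h1 h2 h2
      · have := congrArg F.lev hst
        rw [F.lev_iterate, F.lev_iterate] at this
        omega
      · exact absurd (hst ▸ hm₁ s h1) (hdisj (by omega) _ (hm₂ (t - a₁) (by omega)))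
      · exact absurd (hst ▸ hm₁ t h2) (hdisj (by omega) _ (hm₂ (s - a₁) (by omega)))
      · have := congrArg F.lev hst
        rw [F.lev_iterate, F.lev_iterate] at this
        omega
  · refine (Finset.card_union_le _ _).trans_lt ?_
    by_cases h : 1 ≤ a₂
    · have h2 : ¬ 2 * x ≤ (S.filter (F.Desc c₂)).card := fun h' => hbig₂ ⟨h, h'⟩
      have h3 : S.filter (fun y => 1 ≤ a₂ ∧ F.Desc c₂ y) = S.filter (F.Desc c₂) :=
        Finset.filter_congr fun y _ => by simp [h]
      rw [h3]
      omega
    · simp only [h, false_and, Finset.filter_false, Finset.card_empty]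
      omega

end LevelTree

/-! ### The family of covers of a bough and its average price -/

namespace LevelTree

variable {N : Type*} {F : LevelTree N}

namespace Bough

variable {S : Finset N} {x : ℕ} (b : Bough F S x)

/-- The nodes hanging from the path that come first outside of the reach of the balls meeting
between the path nodes `J - 1` and `J`. -/
def front (J : ℕ) : Finset N :=
  b.T.filter fun y => 1 ≤ b.A y ∧ (b.A y + b.B y = J ∨ b.A y + J = b.B y + 1)

variable {b}

/-- Regard `y` as casting the shadow [B-A, B+A] on the path. A ball covering an interval of the path
covers every node whose shadow lies inside it. -/
theorem covers_of_interval {y : N} (hy : y ∈ b.T) {s r : ℕ} (h1 : b.A y + s ≤ b.B y)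
    (h2 : b.A y + b.B y ≤ s + 2 * r) : F.Covers (b.P (min (s + r) (b.L - 1))) r y := by
  have h3 := b.A_add_lt y hy
  -- The centre is truncated to the last path node, since an interval may run past the end.
  obtain ⟨i, j, h4, h5⟩ := b.path (b.B y) (by omega) (min (s + r) (b.L - 1)) (by omega)
  refine ⟨i, j + b.A y, by omega, ?_⟩
  rw [h5, Function.iterate_add_apply, b.join y hy]

theorem iterate_mem {y : N} (hy : y ∈ b.T) : ∀ t < b.A y,
    F.par^[t] y ∈ b.T ∧ b.A (F.par^[t] y) + t = b.A y ∧ b.B (F.par^[t] y) = b.B y := by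
  intro t
  induction t with
  | zero => exact fun _ => ⟨hy, rfl, rfl⟩
  | succ t ih =>
    intro ht
    obtain ⟨h1, h2, h3⟩ := ih (by omega)
    obtain ⟨h4, h5, h6⟩ := b.par_mem _ h1 (by omega)
    rw [Function.iterate_succ_apply']
    exact ⟨h4, by omega, by omega⟩

/-- If the shadow of `y` crosses the split at `J`, climb towards the path: the shadow shrinks by one
at each end, and the last ancestor whose shadow still crosses is in the front. -/
theorem exists_front {y : N} (hy : y ∈ b.T) {J : ℕ}
    (h : (b.B y < J ∧ J ≤ b.A y + b.B y) ∨ (J ≤ b.B y ∧ b.B y + 1 ≤ b.A y + J)) :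
    ∃ z ∈ b.front J, F.Covers z (F.ht S z) y := by
  obtain ⟨t, ht, ht'⟩ : ∃ t < b.A y,
      (b.A y - t + b.B y = J ∨ b.A y - t + J = b.B y + 1) := by
    rcases h with h | h
    · exact ⟨b.A y + b.B y - J, by omega, by omega⟩
    · exact ⟨b.A y + J - (b.B y + 1), by omega, by omega⟩
  obtain ⟨h1, h2, h3⟩ := iterate_mem hy t ht
  refine ⟨F.par^[t] y, ?_, covers_ht (b.sub hy) (desc_iterate ?_)⟩
  · rw [front, Finset.mem_filter]
    exact ⟨h1, by omega, by omega⟩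
  · have := b.A_le_lev y hy
    omega

variable (b)

/-- The parameter of the family of covers: the length of the path exceeds `2x` by about `2τ`. -/
def excess : ℕ := (b.L + 3) / 2 - x

/-- The balls around the nodes of `front J`. -/
noncomputable def singles (J : ℕ) : Multiset (N × ℕ) :=
  (b.front J).val.map fun y => (y, F.ht S y)

/-- A ball of radius `r` covering the path nodes `s, …, s + 2r`. -/
def interval (s r : ℕ) : N × ℕ := (b.P (min (s + r) (b.L - 1)), r)

/-- The `i`-th cover of a bough. -/
noncomputable def cover (i : ℕ) : Multiset (N × ℕ) :=
  if i < b.excess then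
    {b.interval 0 i, b.interval (2 * i + 1) (x - 1),
      b.interval (2 * (x - 1 + i) + 1) (b.excess - 1 - i)} +
      (b.singles (2 * i + 1) + b.singles (2 * (x - 1 + i) + 1))
  else {b.interval 0 i, b.interval (2 * i + 1) (x + b.excess - 2 - i)} + b.singles (2 * i + 1)

variable {b}

theorem excess_spec : b.L + 2 ≤ 2 * x + 2 * b.excess ∧ 2 * x + 2 * b.excess ≤ b.L + 3 ∧
    b.excess + 1 ≤ x := by
  have := b.le_L
  have := b.L_le
  unfold excess
  omega

/-- Every shadow lies in [0, L-1], so it fits into one of the intervals or crosses a split. In the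
three-ball case the last two intervals share one node, which keeps the second split at an odd
position. -/
theorem covers_cover (hx : 3 ≤ x) (i : ℕ) {y : N} (hy : y ∈ b.T) :
    ∃ p ∈ b.cover i, F.Covers p.1 p.2 y := by
  obtain ⟨e1, e2, e3⟩ := b.excess_spec
  have h1 := b.A_le y hy
  have h2 := b.A_add_lt y hy
  have hs : ∀ J, ((b.B y < J ∧ J ≤ b.A y + b.B y) ∨ (J ≤ b.B y ∧ b.B y + 1 ≤ b.A y + J)) →
      ∃ p ∈ b.singles J, F.Covers p.1 p.2 y := fun J h => by
    obtain ⟨z, hz, hc⟩ := exists_front hy h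
    exact ⟨_, Multiset.mem_map_of_mem _ hz, hc⟩
  have hint : ∀ s r, b.A y + s ≤ b.B y → b.A y + b.B y ≤ s + 2 * r →
      F.Covers (b.interval s r).1 (b.interval s r).2 y := fun s r => covers_of_interval hy
  unfold cover
  split_ifs with hlt
  · by_cases c1 : b.A y + b.B y ≤ 2 * i
    · exact ⟨b.interval 0 i, by simp, hint _ _ (by omega) (by omega)⟩
    by_cases c2 : b.B y < 2 * i + 1 ∨ b.B y + 1 ≤ b.A y + (2 * i + 1)
    · obtain ⟨p, hp, hc⟩ := hs (2 * i + 1) (by omega)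
      exact ⟨p, Multiset.mem_add.2 (.inr (Multiset.mem_add.2 (.inl hp))), hc⟩
    by_cases c3 : b.A y + b.B y ≤ 2 * i + 1 + 2 * (x - 1)
    · exact ⟨b.interval (2 * i + 1) (x - 1), by simp, hint _ _ (by omega) (by omega)⟩
    by_cases c4 : b.B y < 2 * (x - 1 + i) + 1 ∨ b.B y + 1 ≤ b.A y + (2 * (x - 1 + i) + 1)
    · obtain ⟨p, hp, hc⟩ := hs (2 * (x - 1 + i) + 1) (by omega)
      exact ⟨p, Multiset.mem_add.2 (.inr (Multiset.mem_add.2 (.inr hp))), hc⟩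
    · exact ⟨b.interval (2 * (x - 1 + i) + 1) (b.excess - 1 - i), by simp,
        hint _ _ (by omega) (by omega)⟩
  · by_cases c1 : b.A y + b.B y ≤ 2 * i
    · exact ⟨b.interval 0 i, by simp, hint _ _ (by omega) (by omega)⟩
    by_cases c2 : b.B y < 2 * i + 1 ∨ b.B y + 1 ≤ b.A y + (2 * i + 1)
    · obtain ⟨p, hp, hc⟩ := hs (2 * i + 1) (by omega)
      exact ⟨p, Multiset.mem_add.2 (.inr hp), hc⟩
    · exact ⟨b.interval (2 * i + 1) (x + b.excess - 2 - i), by simp,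
        hint _ _ (by omega) (by omega)⟩

theorem card_front_le (J : ℕ) : (b.front J).card ≤ b.T.card :=
  Finset.card_le_card (Finset.filter_subset _ _)

theorem card_cover_le (i : ℕ) : (b.cover i).card ≤ 3 + 2 * b.T.card := by
  have h1 := b.card_front_le (2 * i + 1)
  have h2 := b.card_front_le (2 * (x - 1 + i) + 1)
  unfold cover
  split_ifs
  · simp only [singles, Multiset.card_add, Multiset.card_map, Multiset.insert_eq_cons,
      Multiset.card_cons, Multiset.card_singleton, Finset.card_val]
    omega
  · simp only [singles, Multiset.card_add, Multiset.card_map, Multiset.insert_eq_cons,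
      Multiset.card_cons, Multiset.card_singleton, Finset.card_val]
    omega

theorem radius_lt {i : ℕ} (hi : i < x - 1) {p : N × ℕ} (hp : p ∈ b.cover i) : p.2 < x := by
  obtain ⟨e1, e2, e3⟩ := b.excess_spec
  have hs : ∀ J, p ∈ b.singles J → p.2 < x := fun J h => by
    obtain ⟨y, hy, rfl⟩ := Multiset.mem_map.1 h
    obtain ⟨hy, hA, -⟩ := Finset.mem_filter.1 hy
    exact b.ht_lt y hy hA
  unfold cover at hp
  split_ifs at hp
  · rcases Multiset.mem_add.1 hp with hp | hp
    · simp only [Multiset.insert_eq_cons, Multiset.mem_cons, Multiset.mem_singleton] at hp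
      rcases hp with rfl | rfl | rfl <;> simp only [interval] <;> omega
    · rcases Multiset.mem_add.1 hp with hp | hp
      · exact hs _ hp
      · exact hs _ hp
  · rcases Multiset.mem_add.1 hp with hp | hp
    · simp only [Multiset.insert_eq_cons, Multiset.mem_cons, Multiset.mem_singleton] at hp
      rcases hp with rfl | rfl <;> simp only [interval] <;> omega
    · exact hs _ hp

variable (b)

/-- The total price of the balls around the nodes of `front (2 * j + 1)`. -/
noncomputable def frontPrice (w : ℕ → ℝ) (j : ℕ) : ℝ :=
  ∑ y ∈ b.front (2 * j + 1), w (F.ht S y)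

variable {b}

theorem price_cover (w : ℕ → ℝ) (i : ℕ) : ((b.cover i).map fun p => w p.2).sum =
    if i < b.excess then w i + w (x - 1) + w (b.excess - 1 - i) + b.frontPrice w i +
      b.frontPrice w (x - 1 + i)
    else w i + w (x + b.excess - 2 - i) + b.frontPrice w i := by
  have hs : ∀ j, ((b.singles (2 * j + 1)).map fun p => w p.2).sum = b.frontPrice w j := by
    intro j
    simp only [singles, frontPrice, Multiset.map_map, Function.comp_def]
    rfl
  unfold cover
  split_ifs
  · simp only [Multiset.map_add, Multiset.sum_add, hs, Multiset.insert_eq_cons, Multiset.map_cons,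
      Multiset.map_singleton, Multiset.sum_cons, Multiset.sum_singleton, interval]
    ring
  · simp only [Multiset.map_add, Multiset.sum_add, hs, Multiset.insert_eq_cons, Multiset.map_cons,
      Multiset.map_singleton, Multiset.sum_cons, Multiset.sum_singleton, interval]

/-- The numbers A+B and B-A+1 have opposite parity, so a node lies in the front of exactly one odd
position at most. -/
theorem sum_frontPrice_le {w : ℕ → ℝ} (hw : ∀ i, 0 ≤ w i) (M : ℕ) :
    ∑ j ∈ Finset.range M, b.frontPrice w j ≤
      ∑ y ∈ b.T.filter (fun y => 1 ≤ b.A y), w (F.ht S y) := by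
  classical
  unfold frontPrice
  rw [← Finset.sum_biUnion]
  · refine Finset.sum_le_sum_of_subset_of_nonneg ?_ fun _ _ _ => hw _
    intro y hy
    obtain ⟨j, -, hy⟩ := Finset.mem_biUnion.1 hy
    obtain ⟨h1, h2, -⟩ := Finset.mem_filter.1 hy
    exact Finset.mem_filter.2 ⟨h1, h2⟩
  · intro i _ j _ hij
    refine Finset.disjoint_left.2 fun y hi hj => ?_
    obtain ⟨-, h1, h2⟩ := Finset.mem_filter.1 hi
    obtain ⟨-, -, h3⟩ := Finset.mem_filter.1 hj
    omega

theorem sum_price_le (hx : 3 ≤ x) {w : ℕ → ℝ} (hw : ∀ i, 0 ≤ w i) :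
    ∑ i ∈ Finset.range (x - 1), ((b.cover i).map fun p => w p.2).sum ≤
      2 * ∑ i ∈ Finset.range x, w i + b.excess * w (x - 1) +
      ∑ y ∈ b.T.filter (fun y => 1 ≤ b.A y), w (F.ht S y) := by
  obtain ⟨e1, e2, e3⟩ := b.excess_spec
  -- The family has `b.excess` three-ball covers and `ρ` two-ball covers. In each group the paired
  -- radii run through the same range in opposite orders, so every price occurs twice.
  obtain ⟨ρ, hρ⟩ : ∃ ρ, x = b.excess + ρ + 1 := ⟨x - (b.excess + 1), by omega⟩
  refine le_trans (le_of_eq ?_) (add_le_add_right (b.sum_frontPrice_le hw (x - 1 + b.excess)) _)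
    |>.trans (add_le_add_left (add_le_add_left (mul_le_mul_of_nonneg_left
      (Finset.sum_le_sum_of_subset_of_nonneg (Finset.range_mono (Nat.sub_le x 1))
        fun i _ _ => hw i) zero_le_two) _) _)
  simp only [price_cover]
  generalize hτ : b.excess = τ at *
  generalize hf : b.frontPrice w = f
  rw [show x - 1 = τ + ρ by omega]
  have h1 : ∀ i ∈ Finset.range τ, (if i < τ then w i + w (τ + ρ) + w (τ - 1 - i) + f i +
      f (τ + ρ + i) else w i + w (x + τ - 2 - i) + f i) =
      w i + w (τ + ρ) + w (τ - 1 - i) + f i + f (τ + ρ + i) := fun i hi =>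
    if_pos (Finset.mem_range.1 hi)
  have h2 : ∀ i ∈ Finset.range ρ, (if τ + i < τ then w (τ + i) + w (τ + ρ) + w (τ - 1 - (τ + i)) +
      f (τ + i) + f (τ + ρ + (τ + i)) else w (τ + i) + w (x + τ - 2 - (τ + i)) + f (τ + i)) =
      w (τ + i) + w (τ + (ρ - 1 - i)) + f (τ + i) := fun i hi => by
    have := Finset.mem_range.1 hi
    rw [if_neg (by omega), show x + τ - 2 - (τ + i) = τ + (ρ - 1 - i) by omega]
  rw [Finset.sum_range_add, Finset.sum_congr rfl h1, Finset.sum_congr rfl h2,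
    Finset.sum_range_add (fun i => w i), Finset.sum_range_add f (τ + ρ) τ,
    Finset.sum_range_add f τ ρ]
  simp only [Finset.sum_add_distrib, Finset.sum_const, Finset.card_range, nsmul_eq_mul]
  rw [Finset.sum_range_reflect (fun i => w i) τ, Finset.sum_range_reflect (fun i => w (τ + i)) ρ]
  ring

/-- A node of height `j + 1` has a child of height `j`, which also hangs off the path, and distinct
nodes have distinct children. -/
theorem card_ht_succ_le (hS : ∀ v ∈ S, F.par v ∈ S) (j : ℕ) :
    ((b.T.filter fun y => 1 ≤ b.A y).filter fun y => F.ht S y = j + 1).card ≤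
      ((b.T.filter fun y => 1 ≤ b.A y).filter fun y => F.ht S y = j).card := by
  classical
  refine (Finset.card_le_card fun y hy => ?_).trans (Finset.card_image_le (f := F.par))
  simp only [Finset.mem_filter] at hy
  obtain ⟨⟨hy, hA⟩, hh⟩ := hy
  obtain ⟨z, hz, ⟨k, hk1, hk2⟩, hk⟩ := exists_ht_eq (F := F) (b.sub hy)
  obtain rfl : k = j + 1 := by omega
  rw [Function.iterate_succ_apply'] at hk2
  have hSi : ∀ k, F.par^[k] z ∈ S := fun k => by
    induction k with
    | zero => exact hz
    | succ k ih => rw [Function.iterate_succ_apply']; exact hS _ ih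
  have hcl : F.lev (F.par^[j] z) = F.lev y + 1 := by rw [F.lev_iterate]; omega
  refine Finset.mem_image.2 ⟨F.par^[j] z, ?_, hk2⟩
  simp only [Finset.mem_filter]
  refine ⟨⟨b.down _ (hSi j) (hk2.symm ▸ hy), b.child _ (hSi j) (hk2.symm ▸ hy) (hk2.symm ▸ hA)⟩,
    le_antisymm ?_ ?_⟩
  · obtain ⟨v, hv, hd, he⟩ := exists_ht_eq (F := F) (hSi j)
    have := le_ht hv (.trans ⟨1, hcl, hk2⟩ hd)
    omega
  · have := le_ht hz (y := F.par^[j] z) (desc_iterate (by omega))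
    omega

/-- Chebyshev's sum inequality: prices increase with the height while the number of nodes of that
height decreases. -/
theorem sum_ht_le (hS : ∀ v ∈ S, F.par v ∈ S) {w : ℕ → ℝ}
    (hmono : ∀ i j, i ≤ j → j < x → w i ≤ w j) :
    x * ∑ y ∈ b.T.filter (fun y => 1 ≤ b.A y), w (F.ht S y) ≤
      (∑ i ∈ Finset.range x, w i) * (b.T.filter fun y => 1 ≤ b.A y).card := by
  set D := b.T.filter fun y => 1 ≤ b.A y with hD
  have hmap : ∀ y ∈ D, F.ht S y ∈ Finset.range x := fun y hy => by
    obtain ⟨h1, h2⟩ := Finset.mem_filter.1 hy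
    exact Finset.mem_range.2 (b.ht_lt y h1 h2)
  let n : ℕ → ℝ := fun j => ((D.filter fun y => F.ht S y = j).card : ℝ)
  have hn : Antitone n := antitone_nat_of_succ_le fun j =>
    Nat.cast_le.2 (b.card_ht_succ_le hS j)
  have h1 : ∑ y ∈ D, w (F.ht S y) = ∑ j ∈ Finset.range x, w j * n j := by
    rw [← Finset.sum_fiberwise_of_maps_to hmap]
    refine Finset.sum_congr rfl fun j _ => ?_
    rw [Finset.sum_congr rfl fun y hy => by rw [(Finset.mem_filter.1 hy).2], Finset.sum_const,
      nsmul_eq_mul, mul_comm]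
  have h2 : (D.card : ℝ) = ∑ j ∈ Finset.range x, n j := by
    rw [Finset.card_eq_sum_card_fiberwise hmap]
    push_cast
    rfl
  have h3 : AntivaryOn w n (Finset.range x) := fun i hi j hj hij => by
    have : j ≤ i := by
      by_contra! h
      exact absurd (hn h.le) (not_le.2 hij)
    exact hmono j i this (by simpa using hi)
  have h4 := h3.card_mul_sum_le_sum_mul_sum
  rw [h1, h2]
  simpa using h4

theorem exists_cover (hS : ∀ v ∈ S, F.par v ∈ S) (hx : 3 ≤ x) {w : ℕ → ℝ} (hw : ∀ i, 0 ≤ w i)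
    (hmono : ∀ i j, i ≤ j → j < x → w i ≤ w j) {ε : ℝ} (hεx : 4 ≤ ε * x)
    (hW : ∑ i ∈ Finset.range x, w i ≤ (1 - ε) * x ^ 2) (hwx : w (x - 1) ≤ 2 * x - 1) :
    ∃ i < x - 1, ((b.cover i).map fun p => w p.2).sum ≤ b.T.card := by
  obtain ⟨e1, e2, e3⟩ := b.excess_spec
  have hsum := b.sum_price_le hx hw
  have hht := b.sum_ht_le hS hmono
  set D := b.T.filter fun y => 1 ≤ b.A y with hD
  -- Besides the hanging nodes `D` there are at least L-1 path nodes, and L ≥ 2x + 2τ - 3, where τ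
  -- is the excess.
  have hcard : (b.T.card : ℝ) ≥ D.card + (2 * x + 2 * b.excess - 4) := by
    have h1 := Finset.card_filter_add_card_filter_not (s := b.T) (fun y => 1 ≤ b.A y)
    have h2 : (b.T.filter fun y => ¬ 1 ≤ b.A y) = b.T.filter fun y => b.A y = 0 :=
      Finset.filter_congr fun y _ => by omega
    rw [h2, ← hD] at h1
    have h3 := b.le_card
    have h4 : D.card + (2 * x + 2 * b.excess) ≤ b.T.card + 4 := by omega
    have h5 : ((D.card + (2 * x + 2 * b.excess) : ℕ) : ℝ) ≤ ((b.T.card + 4 : ℕ) : ℝ) :=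
      Nat.cast_le.2 h4
    push_cast at h5
    linarith
  have hx' : (3 : ℝ) ≤ x := by exact_mod_cast hx
  have hτ : (b.excess : ℝ) + 1 ≤ x := by exact_mod_cast e3
  have hτ0 : (0 : ℝ) ≤ b.excess := Nat.cast_nonneg _
  have hD0 : (0 : ℝ) ≤ D.card := Nat.cast_nonneg _
  have hE : ∑ y ∈ D, w (F.ht S y) ≤ (x - 1) * D.card := by
    refine le_of_mul_le_mul_left (hht.trans ?_) (by linarith : (0 : ℝ) < x)
    rw [← mul_assoc]
    refine mul_le_mul_of_nonneg_right (hW.trans ?_) hD0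
    nlinarith
  -- The saving 2εx² ≥ 8x in the price of the path balls absorbs all linear terms.
  have htot : ∑ i ∈ Finset.range (x - 1), ((b.cover i).map fun p => w p.2).sum ≤
      ∑ i ∈ Finset.range (x - 1), (b.T.card : ℝ) := by
    refine hsum.trans ?_
    rw [Finset.sum_const, Finset.card_range, nsmul_eq_mul, Nat.cast_sub (by omega), Nat.cast_one]
    have h1 : (b.excess : ℝ) * w (x - 1) ≤ b.excess * (2 * x - 1) :=
      mul_le_mul_of_nonneg_left hwx hτ0
    have h2 : ((x : ℝ) - 1) * (D.card + (2 * x + 2 * b.excess - 4)) ≤ (x - 1) * b.T.card :=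
      mul_le_mul_of_nonneg_left hcard (by linarith)
    nlinarith
  obtain ⟨i, hi, h⟩ := Finset.exists_le_of_sum_le ⟨0, Finset.mem_range.2 (by omega)⟩ htot
  exact ⟨i, Finset.mem_range.1 hi, h⟩

end Bough

end LevelTree

/-! ### Arbitrary prices and multiplicative weights -/

namespace LevelTree

variable {N : Type*} {F : LevelTree N}

theorem exists_covers_of_forall_good {S : Finset N} (hS : ∀ v ∈ S, F.par v ∈ S)
    (hne : S.Nonempty) {x : ℕ} (hx : 2 ≤ x) (hgood : ∀ v ∈ S, F.Good (2 * x - 4) S v) :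
    ∃ c, ∀ y ∈ S, F.Covers c (x - 1) y := by
  obtain ⟨z, hz, hdeep⟩ := Finset.exists_max_image S F.lev hne
  have hSi : ∀ k, F.par^[k] z ∈ S := fun k => by
    induction k with
    | zero => exact hz
    | succ k ih => rw [Function.iterate_succ_apply']; exact hS _ ih
  have h0 : ∀ y, F.lev (F.par^[F.lev y] y) = 0 := fun y => by rw [F.lev_iterate]; omega
  refine ⟨_, fun y hy => covers_of_good (c := F.par^[F.lev z] z) (n := F.lev z) ?_ rfl ?_ hz hy
    (hdeep y hy) hx (hgood _ (hSi _))⟩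
  · rw [h0]; omega
  · rw [F.eq_of_lev _ _ (h0 z) (h0 y)]
    exact desc_iterate le_rfl

/-- The radii below `x` are cheap for an optimal choice of `x`. -/
theorem exists_cheap_radius {w : ℕ → ℝ} (hw : ∀ i, 0 ≤ w i) {ε : ℝ} (hε : 0 < ε) {m : ℕ}
    (hm : 16 ≤ ε ^ 3 * (m : ℝ) ^ 2) (hW : ∑ i ∈ Finset.range m, w i ≤ (1 - ε) * (m : ℝ) ^ 2) :
    ∃ x ≤ m, 4 ≤ ε * x ∧ ∑ i ∈ Finset.range x, w i ≤ (1 - ε) * (x : ℝ) ^ 2 ∧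
      w (x - 1) ≤ 2 * x - 1 := by
  obtain ⟨x, hx, hmin⟩ := Finset.exists_min_image (Finset.range (m + 1))
    (fun x : ℕ => ∑ i ∈ Finset.range x, w i - (x : ℝ) ^ 2) ⟨0, by simp⟩
  have hxm : x ≤ m := Nat.lt_succ_iff.1 (Finset.mem_range.1 hx)
  have h1 := hmin m (by simp)
  have h2 : 0 ≤ ∑ i ∈ Finset.range x, w i := Finset.sum_nonneg fun i _ => hw i
  have h3 : ε * (m : ℝ) ^ 2 ≤ (x : ℝ) ^ 2 := by linarith
  -- Comparison of the minimum with `m` gave x² ≥ εm², hence (εx)² ≥ ε³m² ≥ 16.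
  have h4 : 4 ≤ ε * x := by
    refine (pow_le_pow_iff_left₀ (by norm_num) (by positivity) two_ne_zero).1 ?_
    nlinarith [mul_le_mul_of_nonneg_left h3 (sq_nonneg ε)]
  have h5 : 1 ≤ x := by
    rcases Nat.eq_zero_or_pos x with rfl | h
    · norm_num at h4
    · exact h
  refine ⟨x, hxm, h4, ?_, ?_⟩
  · have h6 : (x : ℝ) ^ 2 ≤ (m : ℝ) ^ 2 := by gcongr
    nlinarith
  · have h6 := hmin (x - 1) (by simp; omega)
    obtain ⟨y, rfl⟩ : ∃ y, x = y + 1 := ⟨x - 1, by omega⟩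
    rw [Nat.add_sub_cancel, Finset.sum_range_succ] at h6
    push_cast at h6 ⊢
    nlinarith

theorem exists_step_of_monotone {S : Finset N} (hS : ∀ v ∈ S, F.par v ∈ S) (hne : S.Nonempty)
    {ε : ℝ} (hε : 0 < ε) (hε1 : ε < 1) {m : ℕ} (hm : 16 ≤ ε ^ 3 * (m : ℝ) ^ 2) {w : ℕ → ℝ}
    (hw : ∀ i, 0 ≤ w i) (hmono : ∀ i j, i ≤ j → j < m → w i ≤ w j)
    (hW : ∑ i ∈ Finset.range m, w i ≤ (1 - ε) * (m : ℝ) ^ 2) :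
    (∃ c, ∃ r < m, ∀ y ∈ S, F.Covers c r y) ∨
    ∃ T ⊆ S, T.Nonempty ∧ (∀ y ∈ S, F.par y ∈ T → y ∈ T) ∧ ∃ B : Multiset (N × ℕ),
      (∀ q ∈ B, q.2 < m) ∧ B.card ≤ 3 + 8 * m ∧ (∀ y ∈ T, ∃ q ∈ B, F.Covers q.1 q.2 y) ∧
      (B.map fun q => w q.2).sum ≤ T.card := by
  classical
  obtain ⟨x, hxm, h4, hWx, hwx⟩ := exists_cheap_radius hw hε hm hW
  have hx4 : 4 < x := by
    by_contra! h
    have : (x : ℝ) ≤ 4 := by exact_mod_cast h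
    nlinarith
  by_cases hgood : ∀ v ∈ S, F.Good (2 * x - 4) S v
  · obtain ⟨c, hc⟩ := exists_covers_of_forall_good hS hne (by omega) hgood
    exact .inl ⟨c, x - 1, by omega, hc⟩
  right
  push Not at hgood
  obtain ⟨v, hv, hv'⟩ := hgood
  obtain ⟨u, hu, hmax⟩ := Finset.exists_max_image (S.filter fun v => ¬ F.Good (2 * x - 4) S v)
    F.lev ⟨v, Finset.mem_filter.2 ⟨hv, hv'⟩⟩
  rw [Finset.mem_filter] at hu
  rcases exists_bough hS (by omega) hu.1 hu.2 (fun v hv hlt => by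
      by_contra h
      have := hmax v (Finset.mem_filter.2 ⟨hv, h⟩)
      omega) with ⟨T, hTS, hdown, hcard, c, hc⟩ | ⟨b, hb⟩
  · refine ⟨T, hTS, Finset.card_pos.1 (by omega), hdown, {(c, x - 1)}, ?_, ?_, ?_, ?_⟩
    · intro q hq
      rw [Multiset.mem_singleton.1 hq]
      change x - 1 < m
      omega
    · rw [Multiset.card_singleton]; omega
    · exact fun y hy => ⟨_, Multiset.mem_singleton_self _, hc y hy⟩
    · rw [Multiset.map_singleton, Multiset.sum_singleton]
      have : ((2 * x : ℕ) : ℝ) ≤ T.card := Nat.cast_le.2 hcard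
      push_cast at this
      linarith
  · obtain ⟨i, hi, hprice⟩ := b.exists_cover hS (by omega) hw
      (fun i j hij hj => hmono i j hij (by omega)) h4 hWx hwx
    refine ⟨b.T, b.sub, Finset.card_pos.1 ?_, b.down, b.cover i, ?_, ?_, ?_, hprice⟩
    · have h1 := b.le_card
      have h2 := b.le_L
      have h3 := Finset.card_filter_le b.T fun y => b.A y = 0
      omega
    · exact fun q hq => (b.radius_lt hi hq).trans_le hxm
    · have := b.card_cover_le i
      omega
    · exact fun y hy => b.covers_cover (by omega) i hy

/-- Reduction to monotone prices: charge for radius `j` the least price of a radius at least `j`,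
and use that larger radius instead. After rescaling the total to at most (1-ε)m²,
`exists_step_of_monotone` applies. -/
theorem exists_step {S : Finset N} (hS : ∀ v ∈ S, F.par v ∈ S) (hne : S.Nonempty)
    {ε : ℝ} (hε : 0 < ε) (hε1 : ε < 1) {m : ℕ} (hm : 16 ≤ ε ^ 3 * (m : ℝ) ^ 2) {p : ℕ → ℝ}
    (hp : ∀ i, 0 < p i) :
    (∃ c, ∃ r < m, ∀ y ∈ S, F.Covers c r y) ∨
    ∃ T ⊆ S, T.Nonempty ∧ (∀ y ∈ S, F.par y ∈ T → y ∈ T) ∧ ∃ B : Multiset (N × ℕ),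
      (∀ q ∈ B, q.2 < m) ∧ B.card ≤ 3 + 8 * m ∧ (∀ y ∈ T, ∃ q ∈ B, F.Covers q.1 q.2 y) ∧
      (B.map fun q => p q.2).sum * ((1 - ε) * (m : ℝ) ^ 2) ≤
        (∑ i ∈ Finset.range m, p i) * T.card := by
  have hm0 : 0 < m := by
    rcases Nat.eq_zero_or_pos m with rfl | h
    · norm_num at hm
    · exact h
  have hσ : ∀ j, ∃ i, j < m → j ≤ i ∧ i < m ∧ ∀ i', j ≤ i' → i' < m → p i ≤ p i' := by
    intro j
    by_cases hj : j < m
    · obtain ⟨i, hi, hmin⟩ := Finset.exists_min_image (Finset.Ico j m) p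
        ⟨j, Finset.mem_Ico.2 ⟨le_rfl, hj⟩⟩
      rw [Finset.mem_Ico] at hi
      exact ⟨i, fun _ => ⟨hi.1, hi.2, fun i' h h' => hmin i' (Finset.mem_Ico.2 ⟨h, h'⟩)⟩⟩
    · exact ⟨0, fun h => absurd h hj⟩
  choose σ hσ using hσ
  set Ψ := ∑ i ∈ Finset.range m, p i with hΨ
  have hΨ0 : 0 < Ψ := Finset.sum_pos (fun i _ => hp i) ⟨0, Finset.mem_range.2 hm0⟩
  set κ := (1 - ε) * (m : ℝ) ^ 2 / Ψ with hκ
  have hm' : (0 : ℝ) < m := by exact_mod_cast hm0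
  have hκ0 : 0 < κ := div_pos (mul_pos (by linarith) (by positivity)) hΨ0
  rcases exists_step_of_monotone hS hne hε hε1 hm (w := fun j => κ * p (σ j))
      (fun i => mul_nonneg hκ0.le (hp _).le)
      (fun i j hij hj => mul_le_mul_of_nonneg_left
        ((hσ i (hij.trans_lt hj)).2.2 _ (hij.trans (hσ j hj).1) (hσ j hj).2.1) hκ0.le)
      (by
        rw [← Finset.mul_sum]
        calc κ * ∑ i ∈ Finset.range m, p (σ i) ≤ κ * Ψ :=
              mul_le_mul_of_nonneg_left (Finset.sum_le_sum fun i hi =>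
                (hσ i (Finset.mem_range.1 hi)).2.2 i le_rfl (Finset.mem_range.1 hi)) hκ0.le
          _ = (1 - ε) * (m : ℝ) ^ 2 := div_mul_cancel₀ _ hΨ0.ne') with
    h | ⟨T, hTS, hT, hdown, B, hB1, hB2, hB3, hB4⟩
  · exact .inl h
  refine .inr ⟨T, hTS, hT, hdown, B.map fun q => (q.1, σ q.2), ?_, ?_, ?_, ?_⟩
  · intro q hq
    obtain ⟨q', hq', rfl⟩ := Multiset.mem_map.1 hq
    exact (hσ _ (hB1 q' hq')).2.1
  · rwa [Multiset.card_map]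
  · intro y hy
    obtain ⟨q, hq, hc⟩ := hB3 y hy
    exact ⟨_, Multiset.mem_map_of_mem _ hq, hc.mono (hσ _ (hB1 q hq)).1⟩
  · rw [Multiset.map_map]
    rw [Multiset.sum_map_mul_left] at hB4
    change (B.map fun q => p (σ q.2)).sum * _ ≤ _
    have h1 : κ * Ψ = (1 - ε) * (m : ℝ) ^ 2 := div_mul_cancel₀ _ hΨ0.ne'
    rw [← h1]
    nlinarith

theorem sum_map_eq_sum_count (p : ℕ → ℝ) {m : ℕ} (B : Multiset (N × ℕ)) (hB : ∀ q ∈ B, q.2 < m) :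
    (B.map fun q => p q.2).sum =
      ∑ j ∈ Finset.range m, p j * ((B.map Prod.snd).count j : ℝ) := by
  induction B using Multiset.induction with
  | empty => simp
  | cons q B ih =>
    have hq : q.2 < m := hB q (Multiset.mem_cons_self _ _)
    rw [Multiset.map_cons, Multiset.sum_cons, ih fun q hq => hB q (Multiset.mem_cons_of_mem hq)]
    simp only [Multiset.map_cons, Multiset.count_cons, Nat.cast_add, Nat.cast_ite, Nat.cast_one,
      Nat.cast_zero, mul_add, mul_ite, mul_one, mul_zero, Finset.sum_add_distrib]
    rw [Finset.sum_ite_eq' (Finset.range m) q.2 p, if_pos (Finset.mem_range.2 hq), add_comm]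

/-- A cover found by multiplicative weights. -/
theorem exists_cover_exp {ε : ℝ} (hε : 0 < ε) (hε1 : ε < 1) {m : ℕ}
    (hm : 16 ≤ ε ^ 3 * (m : ℝ) ^ 2) {γ : ℝ} (hγ : 0 < γ) (hγε : γ * (3 + 8 * m) ≤ ε) (n : ℕ) :
    ∀ S : Finset N, S.card = n → (∀ v ∈ S, F.par v ∈ S) → ∀ U : ℕ → ℕ,
      ∃ B : Multiset (N × ℕ), (∀ q ∈ B, q.2 < m) ∧ (∀ y ∈ S, ∃ q ∈ B, F.Covers q.1 q.2 y) ∧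
        ∑ j ∈ Finset.range m, Real.exp (γ * (U j + (B.map Prod.snd).count j : ℕ)) ≤
          (∑ j ∈ Finset.range m, Real.exp (γ * U j)) *
            Real.exp (γ * (1 + ε) / ((1 - ε) * (m : ℝ) ^ 2) * n + γ) := by
  classical
  induction n using Nat.strong_induction_on with
  | _ n ih =>
  intro S hSn hS U
  have hm0 : (0 : ℝ) < (m : ℝ) ^ 2 := by
    by_contra! h
    nlinarith [pow_pos hε 3]
  have hM : 0 < (1 - ε) * (m : ℝ) ^ 2 := mul_pos (by linarith) hm0
  have hΨ0 : 0 ≤ ∑ j ∈ Finset.range m, Real.exp (γ * U j) :=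
    Finset.sum_nonneg fun _ _ => (Real.exp_pos _).le
  have hbig : γ ≤ γ * (1 + ε) / ((1 - ε) * (m : ℝ) ^ 2) * n + γ := by
    have : 0 ≤ γ * (1 + ε) / ((1 - ε) * (m : ℝ) ^ 2) * n := by positivity
    linarith
  rcases S.eq_empty_or_nonempty with rfl | hne
  · refine ⟨0, by simp, by simp, ?_⟩
    simp only [Multiset.map_zero, Multiset.count_zero, add_zero]
    exact le_mul_of_one_le_right hΨ0 (Real.one_le_exp (hγ.le.trans hbig))
  rcases exists_step (F := F) hS hne hε hε1 hm (p := fun j => Real.exp (γ * U j))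
      (fun _ => Real.exp_pos _) with ⟨c, r, hr, hc⟩ | ⟨T, hTS, hT, hdown, B, hB1, hB2, hB3, hB4⟩
  · refine ⟨{(c, r)}, fun q hq => ?_, fun y hy => ⟨_, Multiset.mem_singleton_self _, hc y hy⟩, ?_⟩
    · rw [Multiset.mem_singleton.1 hq]; exact hr
    · refine le_trans (le_trans (Finset.sum_le_sum fun j _ => ?_) (Finset.sum_mul _ _ _).ge)
        (mul_le_mul_of_nonneg_left (Real.exp_le_exp.2 hbig) hΨ0)
      rw [← Real.exp_add, Real.exp_le_exp, ← mul_add_one]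
      refine mul_le_mul_of_nonneg_left ?_ hγ.le
      have h1 := Multiset.count_le_card j ({r} : Multiset ℕ)
      rw [Multiset.card_singleton] at h1
      rw [Multiset.map_singleton]
      exact_mod_cast Nat.add_le_add_left h1 _
  · have hcard : (S \ T).card + T.card = n := by rw [Finset.card_sdiff_add_card_eq_card hTS, hSn]
    have hTpos := Finset.card_pos.2 hT
    obtain ⟨B', hB1', hB2', hB3'⟩ := ih (S \ T).card (by omega) (S \ T) rfl (by
      intro v hv
      rw [Finset.mem_sdiff] at hv ⊢
      -- The recursion keeps the accumulated usage, so its prices take the balls just chosen into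
      -- account.
      exact ⟨hS v hv.1, fun h => hv.2 (hdown v hv.1 h)⟩) (fun j => U j + (B.map Prod.snd).count j)
    refine ⟨B + B', ?_, ?_, ?_⟩
    · intro q hq
      rcases Multiset.mem_add.1 hq with hq | hq
      · exact hB1 q hq
      · exact hB1' q hq
    · intro y hy
      by_cases hyT : y ∈ T
      · obtain ⟨q, hq, h⟩ := hB3 y hyT
        exact ⟨q, Multiset.mem_add.2 (.inl hq), h⟩
      · obtain ⟨q, hq, h⟩ := hB2' y (Finset.mem_sdiff.2 ⟨hy, hyT⟩)
        exact ⟨q, Multiset.mem_add.2 (.inr hq), h⟩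
    · simp only [Multiset.map_add, Multiset.count_add, ← add_assoc]
      refine hB3'.trans ?_
      set Ψ := ∑ j ∈ Finset.range m, Real.exp (γ * U j) with hΨ
      set κ := γ * (1 + ε) / ((1 - ε) * (m : ℝ) ^ 2) with hκ
      have hstep : ∑ j ∈ Finset.range m, Real.exp (γ * (U j + (B.map Prod.snd).count j : ℕ)) ≤
          Ψ * Real.exp (κ * T.card) := by
        have h1 : ∀ j ∈ Finset.range m, Real.exp (γ * (U j + (B.map Prod.snd).count j : ℕ)) ≤
            Real.exp (γ * U j) +
              γ * (1 + ε) * (Real.exp (γ * U j) * ((B.map Prod.snd).count j : ℝ)) := by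
          intro j _
          set a := (B.map Prod.snd).count j with ha
          have ha1 : a ≤ 3 + 8 * m := by
            refine (Multiset.count_le_card _ _).trans ?_
            rwa [Multiset.card_map]
          have ha2 : (a : ℝ) ≤ 3 + 8 * m := by exact_mod_cast ha1
          have ht0 : 0 ≤ γ * a := by positivity
          have ht1 : γ * a ≤ ε := (mul_le_mul_of_nonneg_left ha2 hγ.le).trans hγε
          -- A step uses at most 3+8m balls, so γa ≤ ε < 1 and the quadratic error (γa)² is at most
          -- εγa.
          have h2 := Real.abs_exp_sub_one_sub_id_le (x := γ * a)
            (by rw [abs_of_nonneg ht0]; linarith)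
          have h3 : Real.exp (γ * a) ≤ 1 + (1 + ε) * (γ * a) := by
            have := (abs_le.1 h2).2
            nlinarith
          rw [Nat.cast_add, mul_add, Real.exp_add]
          have := mul_le_mul_of_nonneg_left h3 (Real.exp_pos (γ * U j)).le
          linarith
        refine (Finset.sum_le_sum h1).trans ?_
        rw [Finset.sum_add_distrib, ← Finset.mul_sum,
          ← sum_map_eq_sum_count (fun j => Real.exp (γ * U j)) B hB1]
        have h4 : (B.map fun q => Real.exp (γ * U q.2)).sum ≤
            Ψ * T.card / ((1 - ε) * (m : ℝ) ^ 2) := (le_div_iff₀ hM).2 hB4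
        have h5 : γ * (1 + ε) * (B.map fun q => Real.exp (γ * U q.2)).sum ≤ Ψ * (κ * T.card) := by
          refine (mul_le_mul_of_nonneg_left h4 (by positivity)).trans (le_of_eq ?_)
          rw [hκ]
          ring
        have h6 := mul_le_mul_of_nonneg_left (Real.add_one_le_exp (κ * T.card)) hΨ0
        linarith
      refine (mul_le_mul_of_nonneg_right hstep (Real.exp_pos _).le).trans (le_of_eq ?_)
      rw [mul_assoc, ← Real.exp_add, ← hcard]
      push_cast
      ring_nf

/-- Any tree with `n` nodes can be covered by balls of radii `0, …, m - 1` such that each radius is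
used about `n / m ^ 2` times. -/
theorem exists_cover [Fintype N] {ε : ℝ} (hε : 0 < ε) (hε1 : ε < 1) {m : ℕ}
    (hm : 16 ≤ ε ^ 3 * (m : ℝ) ^ 2) :
    ∃ B : Multiset (N × ℕ), (∀ q ∈ B, q.2 < m) ∧ (∀ y, ∃ q ∈ B, F.Covers q.1 q.2 y) ∧
      ∀ j < m, ((B.map Prod.snd).count j : ℝ) ≤
        (1 + ε) / ((1 - ε) * (m : ℝ) ^ 2) * Fintype.card N + (1 + Real.log m * (3 + 8 * m) / ε) := by
  set γ := ε / (3 + 8 * m) with hγ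
  have hγ0 : 0 < γ := by positivity
  obtain ⟨B, hB1, hB2, hB3⟩ := exists_cover_exp (F := F) hε hε1 hm hγ0
    (by rw [hγ, div_mul_cancel₀]; positivity) (Fintype.card N) Finset.univ Finset.card_univ
    (fun v _ => Finset.mem_univ _) 0
  refine ⟨B, hB1, fun y => hB2 y (Finset.mem_univ y), fun j hj => ?_⟩
  have hm0 : (0 : ℝ) < m := by exact_mod_cast (by omega : 0 < m)
  -- A single term of the potential is at most its final value; the initial value is `m`, which
  -- produces the `Real.log m` term.
  have h1 := (Finset.single_le_sum (fun i _ => (Real.exp_pos _).le)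
    (Finset.mem_range.2 hj)).trans hB3
  simp only [Pi.zero_apply, zero_add, Nat.cast_zero, mul_zero, Real.exp_zero, Finset.sum_const,
    Finset.card_range, nsmul_eq_mul, mul_one] at h1
  rw [← Real.exp_log hm0, ← Real.exp_add, Real.exp_le_exp, Real.exp_log hm0] at h1
  have h2 : Real.log m * (3 + 8 * m) / ε = Real.log m / γ := by
    rw [hγ]; field_simp
  rw [h2]
  refine le_of_mul_le_mul_left (h1.trans (le_of_eq ?_)) hγ0
  field_simp
  ring

end LevelTree

/-! ### Rooting a metric tree -/

namespace MetricTree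

variable {V : Type*} {T : MetricTree V}

/-- A choice of a root vertex, with the parent of each vertex and its rank, the number of edges
between it and the root. -/
structure Rooting (T : MetricTree V) where
  root : V
  par : V → V
  rank : V → ℕ
  rank_root : rank root = 0
  adj : ∀ v, v ≠ root → T.graph.Adj (par v) v
  rank_par : ∀ v, v ≠ root → rank (par v) + 1 = rank v
  edge : ∀ e ∈ T.graph.edgeSet, ∃ v, v ≠ root ∧ e = s(par v, v)

theorem eq_of_edge_eq {root : V} {par : V → V} {rank : V → ℕ}
    (h : ∀ v, v ≠ root → rank (par v) + 1 = rank v) {v w : V} (hv : v ≠ root) (hw : w ≠ root)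
    (he : s(par v, v) = s(par w, w)) : v = w := by
  rcases Sym2.eq_iff.1 he with ⟨-, h1⟩ | ⟨h1, h2⟩
  · exact h1
  · have := h v hv
    have := h w hw
    rw [h1] at *
    rw [← h2] at *
    omega

/-- The parent is the first step of a shortest walk to the root. The edges to parents are distinct
and number |V|-1, so they are all the edges of the tree. -/
theorem exists_rooting [Finite V] (T : MetricTree V) : Nonempty T.Rooting := by
  classical
  have := Fintype.ofFinite V
  have hconn := T.isTree.connected
  obtain ⟨o⟩ := hconn.nonempty
  have hpar : ∀ v, ∃ w, v ≠ o → T.graph.Adj w v ∧ T.graph.dist w o + 1 = T.graph.dist v o := by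
    intro v
    by_cases hv : v = o
    · exact ⟨o, fun h => absurd hv h⟩
    · obtain ⟨p, hp⟩ := (hconn.preconnected v o).exists_walk_length_eq_dist
      cases p with
      | nil => exact absurd rfl hv
      | cons h p =>
        rename_i w
        refine ⟨w, fun _ => ⟨h.symm, ?_⟩⟩
        have h1 := SimpleGraph.dist_le p
        rw [SimpleGraph.Walk.length_cons] at hp
        have h2 := hconn.dist_triangle (u := v) (v := w) (w := o)
        have h3 : T.graph.dist v w = 1 := SimpleGraph.dist_eq_one_iff_adj.2 h
        omega
  choose par hpar using hpar
  have hrank : ∀ v, v ≠ o → T.graph.dist (par v) o + 1 = T.graph.dist v o :=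
    fun v hv => (hpar v hv).2
  refine ⟨⟨o, par, fun v => T.graph.dist v o, SimpleGraph.dist_self, fun v hv => (hpar v hv).1, hrank, ?_⟩⟩
  have himg : (Finset.univ.erase o).image (fun v => s(par v, v)) = T.graph.edgeFinset := by
    refine Finset.eq_of_subset_of_card_le ?_ ?_
    · intro e he
      obtain ⟨v, hv, rfl⟩ := Finset.mem_image.1 he
      rw [SimpleGraph.mem_edgeFinset, SimpleGraph.mem_edgeSet]
      exact (hpar v (Finset.ne_of_mem_erase hv)).1
    · rw [Finset.card_image_of_injOn, Finset.card_erase_of_mem (Finset.mem_univ o),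
        Finset.card_univ]
      · have := T.isTree.card_edgeFinset
        omega
      · intro v hv w hw h
        exact eq_of_edge_eq (rank := fun v => T.graph.dist v o) hrank (Finset.ne_of_mem_erase hv) (Finset.ne_of_mem_erase hw) h
  intro e he
  rw [← SimpleGraph.mem_edgeFinset, ← himg] at he
  obtain ⟨v, hv, rfl⟩ := Finset.mem_image.1 he
  exact ⟨v, Finset.ne_of_mem_erase hv, rfl⟩

namespace Rooting

variable (R : T.Rooting)

/-- The edge from the parent of a vertex to the vertex. -/
def dart (v : V) (hv : v ≠ R.root) : T.graph.Dart := ⟨(R.par v, v), R.adj v hv⟩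

/-- The distance of a vertex from the root. -/
noncomputable def depth (v : V) : ℝ :=
  ∑ j ∈ Finset.range (R.rank v), T.len s(R.par (R.par^[j] v), R.par^[j] v)

open Classical in
theorem sum_len [Fintype V] :
    ∑ v ∈ Finset.univ.erase R.root, T.len s(R.par v, v) = T.length := by
  have himg : (Finset.univ.erase R.root).image (fun v => s(R.par v, v)) = T.graph.edgeFinset := by
    ext e
    rw [Finset.mem_image, SimpleGraph.mem_edgeFinset]
    constructor
    · rintro ⟨v, hv, rfl⟩
      exact R.adj v (Finset.ne_of_mem_erase hv)
    · intro he
      obtain ⟨v, hv, rfl⟩ := R.edge e he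
      exact ⟨v, Finset.mem_erase.2 ⟨hv, Finset.mem_univ v⟩, rfl⟩
  rw [length, ← SimpleGraph.coe_edgeFinset, finsum_mem_coe_finset, ← himg, Finset.sum_image]
  intro v hv w hw h
  exact eq_of_edge_eq R.rank_par (Finset.ne_of_mem_erase hv) (Finset.ne_of_mem_erase hw) h

theorem depth_eq {v : V} (hv : v ≠ R.root) :
    R.depth v = R.depth (R.par v) + T.len s(R.par v, v) := by
  rw [depth, depth, ← R.rank_par v hv, Finset.sum_range_succ']
  rfl

theorem len_dart {v : V} (hv : v ≠ R.root) :
    T.len (R.dart v hv).edge = R.depth v - R.depth (R.par v) := by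
  rw [R.depth_eq hv, add_sub_cancel_left]
  rfl

theorem depth_par_lt {v : V} (hv : v ≠ R.root) : R.depth (R.par v) < R.depth v := by
  have := dart_len_pos (R.dart v hv)
  rw [R.len_dart] at this
  linarith

theorem depth_root : R.depth R.root = 0 := by
  rw [depth, R.rank_root, Finset.sum_range_zero]

open Classical in
/-- The point at distance `s` from the root on the edge from the parent of `v` to `v`. -/
noncomputable def point (v : V) (s : ℝ) : T.Point :=
  if h : ∃ hv : v ≠ R.root, 0 ≤ s - R.depth (R.par v) ∧
      s - R.depth (R.par v) ≤ T.len (R.dart v hv).edge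
  then Point.onEdge (R.dart v h.1) (s - R.depth (R.par v)) h.2.1 h.2.2
  else Point.vertex R.root

variable {R}

theorem point_eq {v : V} (hv : v ≠ R.root) {s t : ℝ} (hs : s = t - R.depth (R.par v))
    (h0 : 0 ≤ s) (h1 : s ≤ T.len (R.dart v hv).edge) :
    R.point v t = Point.onEdge (R.dart v hv) s h0 h1 := by
  subst hs
  rw [point, dif_pos ⟨hv, h0, h1⟩]

theorem point_depth {v : V} (hv : v ≠ R.root) : R.point v (R.depth v) = Point.vertex v := by
  rw [point_eq hv (R.len_dart hv) (dart_len_pos _).le le_rfl, onEdge_len]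
  rfl

theorem point_depth_par {v : V} (hv : v ≠ R.root) :
    R.point v (R.depth (R.par v)) = Point.vertex (R.par v) := by
  rw [point_eq hv (sub_self _).symm le_rfl (dart_len_pos _).le, onEdge_zero]
  rfl

theorem exists_eq_point (R : T.Rooting) (q : T.Point) :
    q = Point.vertex R.root ∨ ∃ v, v ≠ R.root ∧ ∃ t, R.depth (R.par v) ≤ t ∧ t ≤ R.depth v ∧
      q = R.point v t := by
  rcases q with ⟨v | ⟨d, t, h0, h1⟩⟩
  · by_cases hv : v = R.root
    · exact Or.inl (congrArg Point.vertex hv)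
    · exact Or.inr ⟨v, hv, _, (R.depth_par_lt hv).le, le_rfl, (point_depth hv).symm⟩
  · right
    obtain ⟨v, hv, he⟩ := R.edge _ d.edge_mem
    have hl := R.len_dart hv
    refine ⟨v, hv, ?_⟩
    have hd : d = R.dart v hv ∨ d = (R.dart v hv).symm :=
      SimpleGraph.dart_edge_eq_iff d (R.dart v hv) |>.1 he
    rcases hd with rfl | rfl
    · refine ⟨t + R.depth (R.par v), by linarith, by linarith, ?_⟩
      exact (point_eq hv (by ring) h0 h1).symm
    · have h1' := h1
      rw [SimpleGraph.Dart.edge_symm] at h1'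
      refine ⟨R.depth v - t, by linarith, by linarith, ?_⟩
      rw [point_eq hv (s := T.len (R.dart v hv).edge - t) (by rw [hl]; ring) (by linarith)
        (by linarith)]
      exact (Quot.sound (Glue.flip _ _ _ _ _ _ _ (by ring))).symm

variable [Finite V]

theorem dist_point_point {v : V} (hv : v ≠ R.root) {s t : ℝ} (hs : R.depth (R.par v) ≤ s)
    (hst : s ≤ t) (ht : t ≤ R.depth v) : dist (R.point v t) (R.point v s) ≤ t - s := by
  have hl := R.len_dart hv
  rw [point_eq hv (t := t) rfl (by linarith) (by linarith),
    point_eq hv (t := s) rfl (by linarith) (by linarith)]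
  have := HasPath.step (R.dart v hv) (t - R.depth (R.par v)) (s - R.depth (R.par v))
    (by linarith) (by linarith) (by linarith) (by linarith) HasPath.refl
  refine (pathDist_le this).trans (le_of_eq ?_)
  rw [zero_add, sub_sub_sub_cancel_right, abs_of_nonneg (by linarith)]

theorem dist_vertex_par {v : V} (hv : v ≠ R.root) :
    dist (Point.vertex v : T.Point) (Point.vertex (R.par v)) ≤ R.depth v - R.depth (R.par v) := by
  rw [← point_depth hv, ← point_depth_par hv]
  exact dist_point_point hv le_rfl (R.depth_par_lt hv).le le_rfl

theorem dist_vertex_root (v : V) :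
    dist (Point.vertex v : T.Point) (Point.vertex R.root) ≤ R.depth v := by
  induction h : R.rank v generalizing v with
  | zero =>
    by_cases hv : v = R.root
    · rw [hv, dist_self, depth_root]
    · have := R.rank_par v hv
      omega
  | succ n ih =>
    by_cases hv : v = R.root
    · rw [hv, dist_self, depth_root]
    · have h1 := ih (R.par v) (by have := R.rank_par v hv; omega)
      have h2 := dist_vertex_par hv
      have h3 := dist_triangle (Point.vertex v : T.Point) (Point.vertex (R.par v))
        (Point.vertex R.root)
      linarith

theorem exists_point_of_vertex (v : V) {s : ℝ} (h0 : 0 < s) (hs : s ≤ R.depth v) :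
    ∃ w, w ≠ R.root ∧ R.depth (R.par w) < s ∧ s ≤ R.depth w ∧
      dist (Point.vertex v) (R.point w s) ≤ R.depth v - s := by
  induction h : R.rank v generalizing v with
  | zero =>
    rw [depth, h, Finset.sum_range_zero] at hs
    linarith
  | succ n ih =>
    have hv : v ≠ R.root := by
      rintro rfl
      rw [R.rank_root] at h
      omega
    rcases lt_or_ge (R.depth (R.par v)) s with hp | hp
    · refine ⟨v, hv, hp, hs, ?_⟩
      rw [← point_depth hv]
      exact dist_point_point hv hp.le hs le_rfl
    · obtain ⟨w, hw, h1, h2, h3⟩ := ih (R.par v) hp (by have := R.rank_par v hv; omega)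
      refine ⟨w, hw, h1, h2, ?_⟩
      have h4 := dist_vertex_par hv
      have h5 := dist_triangle (Point.vertex v : T.Point) (Point.vertex (R.par v)) (R.point w s)
      linarith

theorem dist_point_root {v : V} (hv : v ≠ R.root) {t : ℝ} (h0 : R.depth (R.par v) ≤ t)
    (h1 : t ≤ R.depth v) : dist (R.point v t) (Point.vertex R.root) ≤ t := by
  have h2 := dist_point_point hv le_rfl h0 h1
  rw [point_depth_par hv] at h2
  have h3 := dist_vertex_root (R := R) (R.par v)
  have h4 := dist_triangle (R.point v t) (Point.vertex (R.par v)) (Point.vertex R.root)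
  linarith

theorem exists_point {v : V} (hv : v ≠ R.root) {s t : ℝ} (h0 : R.depth (R.par v) ≤ t)
    (h1 : t ≤ R.depth v) (hs : 0 < s) (hst : s ≤ t) :
    ∃ w, w ≠ R.root ∧ R.depth (R.par w) < s ∧ s ≤ R.depth w ∧
      dist (R.point v t) (R.point w s) ≤ t - s := by
  rcases lt_or_ge (R.depth (R.par v)) s with hp | hp
  · exact ⟨v, hv, hp, hst.trans h1, dist_point_point hv hp.le hst h1⟩
  · obtain ⟨w, hw, h2, h3, h4⟩ := exists_point_of_vertex (R.par v) hs hp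
    have h5 := dist_point_point hv le_rfl h0 h1
    rw [point_depth_par hv] at h5
    have h6 := dist_triangle (R.point v t) (Point.vertex (R.par v)) (R.point w s)
    exact ⟨w, hw, h2, h3, by linarith⟩

end Rooting

end MetricTree

/-! ### Averaging over translates of a lattice -/

section

open MeasureTheory

/-- The shifted windows tile [0, nh], so the sum is one integral of the indicator over it. -/
theorem sum_integral_indicator_Ioc_le {α β h : ℝ} (hαβ : α ≤ β) (hh : 0 ≤ h) (n : ℕ) :
    ∑ i ∈ Finset.range n, ∫ θ in (0:ℝ)..h, (Set.Ioc α β).indicator (fun _ => (1:ℝ)) (θ + i * h) ≤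
      β - α := by
  have hint : Integrable ((Set.Ioc α β).indicator (fun _ => (1:ℝ))) :=
    (integrable_indicator_iff measurableSet_Ioc).2 (integrableOn_const (by simp))
  have h1 : ∀ i ∈ Finset.range n,
      ∫ θ in (0:ℝ)..h, (Set.Ioc α β).indicator (fun _ => (1:ℝ)) (θ + i * h) =
      ∫ θ in ((i:ℕ) * h : ℝ)..((i + 1 : ℕ) * h : ℝ), (Set.Ioc α β).indicator (fun _ => (1:ℝ)) θ := by
    intro i _
    rw [intervalIntegral.integral_comp_add_right]
    congr 1 <;> push_cast <;> ring
  rw [Finset.sum_congr rfl h1, intervalIntegral.sum_integral_adjacent_intervals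
    (a := fun i : ℕ => (i * h : ℝ)) fun i _ => hint.intervalIntegrable,
    intervalIntegral.integral_of_le (by simp; positivity)]
  refine (setIntegral_le_integral hint ?_).trans (le_of_eq ?_)
  · exact Filter.Eventually.of_forall fun x => Set.indicator_nonneg (fun _ _ => zero_le_one) x
  · rw [integral_indicator measurableSet_Ioc]
    simp [hαβ]

open Classical in
/-- Some translate of the lattice of mesh `h` meets a finite family of intervals at most as often
as the average translate does. -/
theorem exists_lattice_card_le {ι : Type*} [Fintype ι] {α β : ι → ℝ} (hαβ : ∀ v, α v ≤ β v)
    {h : ℝ} (hh : 0 < h) (n : ℕ) :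
    ∃ θ, 0 < θ ∧ θ ≤ h ∧
      h * (Fintype.card {p : ι × Fin n // α p.1 < θ + p.2 * h ∧ θ + p.2 * h ≤ β p.1} : ℝ) ≤
        ∑ v, (β v - α v) := by
  let f : ℝ → ℝ := fun θ => ∑ v, ∑ i ∈ Finset.range n,
    (Set.Ioc (α v) (β v)).indicator (fun _ => (1:ℝ)) (θ + i * h)
  have hint : ∀ v (i : ℕ), Integrable fun θ : ℝ =>
      (Set.Ioc (α v) (β v)).indicator (fun _ => (1:ℝ)) (θ + i * h) := fun v i =>
    Integrable.comp_add_right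
      ((integrable_indicator_iff measurableSet_Ioc).2 (integrableOn_const (by simp))) _
  have hf : IntegrableOn f (Set.Ioc 0 h) := by
    refine Integrable.integrableOn ?_
    exact integrable_finsetSum _ fun v _ => integrable_finsetSum _ fun i _ => hint v i
  obtain ⟨θ, hθ, hle⟩ := exists_le_setAverage (μ := volume) (s := Set.Ioc 0 h) (f := f)
    (by simp [hh]) (by simp) hf
  refine ⟨θ, hθ.1, hθ.2, ?_⟩
  have hint2 : ∫ θ in Set.Ioc 0 h, f θ ≤ ∑ v, (β v - α v) := by
    rw [integral_finsetSum _ fun v _ => integrable_finsetSum _ fun i _ => (hint v i).integrableOn]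
    refine Finset.sum_le_sum fun v _ => ?_
    rw [integral_finsetSum _ fun i _ => (hint v i).integrableOn]
    refine le_trans (le_of_eq ?_) (sum_integral_indicator_Ioc_le (hαβ v) hh.le n)
    exact Finset.sum_congr rfl fun i _ => (intervalIntegral.integral_of_le hh.le).symm
  have hcard : (Fintype.card {p : ι × Fin n // α p.1 < θ + p.2 * h ∧ θ + p.2 * h ≤ β p.1} : ℝ) =
      f θ := by
    rw [Fintype.card_subtype, ← Finset.sum_boole, ← Finset.univ_product_univ, Finset.sum_product]
    refine Finset.sum_congr rfl fun v _ => ?_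
    rw [Finset.sum_range]
    refine Finset.sum_congr rfl fun i _ => ?_
    rw [Set.indicator_apply]
    rfl
  rw [setAverage_eq, smul_eq_mul] at hle
  rw [hcard]
  have hv : volume.real (Set.Ioc 0 h) = h := by simp [hh.le]
  rw [hv, inv_mul_eq_div, le_div_iff₀ hh] at hle
  linarith

end

-- Discretising a metric tree

universe u

namespace MetricTree

open Classical in
/-- The root of a metric tree and the points whose distance from it lies in a suitable translate of
`h ℕ` form a levelled tree which approximates the metric tree. -/
theorem exists_levelTree {V : Type u} [Finite V] (T : MetricTree V) {h : ℝ} (hh : 0 < h) :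
    ∃ (ι : Type u) (_ : Fintype ι) (F : LevelTree (Option ι)) (pt : Option ι → T.Point),
      h * Fintype.card (Option ι) ≤ T.length + h ∧ (∀ y, dist (pt y) (pt (F.par y)) ≤ h) ∧
      ∀ q, ∃ y, dist q (pt y) ≤ h := by
  have := Fintype.ofFinite V
  obtain ⟨R⟩ := exists_rooting T
  obtain ⟨M, hM⟩ := (Set.finite_range R.depth).bddAbove
  obtain ⟨n, hn⟩ := exists_nat_gt (M / h)
  have hn : ∀ v, R.depth v < n * h := fun v =>
    (hM ⟨v, rfl⟩).trans_lt ((div_lt_iff₀ hh).1 hn)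
  obtain ⟨θ, hθ, hθh, hcard⟩ := exists_lattice_card_le
    (ι := {v // v ≠ R.root}) (α := fun v => R.depth (R.par v)) (β := fun v => R.depth v)
    (fun v => (R.depth_par_lt v.2).le) hh n
  -- Edges are open at the parent's end, so a lattice point at a vertex is not counted again for
  -- each edge going down. The root is added as `none`.
  let ι := {p : {v // v ≠ R.root} × Fin n //
    R.depth (R.par p.1) < θ + p.2 * h ∧ θ + p.2 * h ≤ R.depth p.1}
  let lev : Option ι → ℕ := fun y => y.elim 0 fun p => p.1.2 + 1
  let pt : Option ι → T.Point := fun y =>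
    y.elim (Point.vertex R.root) fun p => R.point p.1.1 (θ + p.1.2 * h)
  -- Climbing from any point towards the root meets every lattice level not exceeding its depth.
  have key : ∀ (v : V) (t : ℝ) (i : ℕ), v ≠ R.root → R.depth (R.par v) ≤ t → t ≤ R.depth v →
      θ + i * h ≤ t → ∃ y, lev y = i + 1 ∧ dist (R.point v t) (pt y) ≤ t - (θ + i * h) := by
    intro v t i hv h0 h1 h2
    obtain ⟨w, hw, h3, h4, h5⟩ := Rooting.exists_point hv h0 h1 (by positivity) h2
    have hi : i < n := by
      have : (i * h : ℝ) < n * h := by linarith [hn v]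
      exact_mod_cast lt_of_mul_lt_mul_right this hh.le
    exact ⟨some ⟨(⟨w, hw⟩, ⟨i, hi⟩), h3, h4⟩, rfl, h5⟩
  have hpar : ∀ y, ∃ y', lev y' = lev y - 1 ∧ dist (pt y) (pt y') ≤ h := by
    rintro (_ | ⟨⟨⟨v, hv⟩, i, hi⟩, h1, h2⟩)
    · exact ⟨none, rfl, by rw [dist_self]; exact hh.le⟩
    · simp only at h1 h2
      cases i with
      | zero =>
        refine ⟨none, rfl, (Rooting.dist_point_root hv h1.le h2).trans ?_⟩
        simpa using hθh
      | succ i =>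
        obtain ⟨y, hy, hd⟩ := key v _ i hv h1.le h2 (by push_cast; linarith)
        refine ⟨y, hy, hd.trans (le_of_eq ?_)⟩
        push_cast
        ring
  choose par hlev hdist using hpar
  refine ⟨ι, inferInstance, ⟨par, lev, hlev, ?_⟩, pt, ?_, hdist, ?_⟩
  · rintro (_ | p) (_ | q) h1 h2
    · rfl
    · exact absurd h2 (Nat.succ_ne_zero _)
    · exact absurd h1 (Nat.succ_ne_zero _)
    · exact absurd h1 (Nat.succ_ne_zero _)
  · have hsum : ∑ v : {v // v ≠ R.root}, (R.depth v - R.depth (R.par v)) = T.length := by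
      rw [← R.sum_len, ← Finset.sum_subtype_of_mem (p := fun v => v ≠ R.root)
        (fun v => T.len s(R.par v, v)) fun v hv => Finset.ne_of_mem_erase hv]
      refine Finset.sum_congr ?_ fun v _ => (R.len_dart v.2).symm
      ext v
      simp [v.2]
    rw [hsum] at hcard
    rw [Fintype.card_option]
    push_cast
    linarith
  · intro q
    rcases R.exists_eq_point q with rfl | ⟨v, hv, t, h0, h1, rfl⟩
    · exact ⟨none, by rw [show pt none = Point.vertex R.root from rfl, dist_self]; exact hh.le⟩
    · rcases lt_or_ge t θ with ht | ht
      · exact ⟨none, (Rooting.dist_point_root hv h0 h1).trans (by linarith)⟩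
      · have hf := Nat.floor_le (div_nonneg (sub_nonneg.2 ht) hh.le)
        have hf' := Nat.lt_floor_add_one ((t - θ) / h)
        rw [le_div_iff₀ hh] at hf
        rw [div_lt_iff₀ hh] at hf'
        obtain ⟨y, -, hy⟩ := key v t ⌊(t - θ) / h⌋₊ hv h0 h1 (by linarith)
        exact ⟨y, by linarith⟩

end MetricTree

/-! ### Returning to metric balls with distinct radii -/

theorem LevelTree.Covers.dist_le {N X : Type*} [PseudoMetricSpace X] {F : LevelTree N} {pt : N → X}
    {h : ℝ} (hpt : ∀ y, dist (pt y) (pt (F.par y)) ≤ h) {c y : N} {r : ℕ}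
    (hc : F.Covers c r y) : dist (pt c) (pt y) ≤ r * h := by
  have key : ∀ (i : ℕ) (x : N), dist (pt x) (pt (F.par^[i] x)) ≤ i * h := by
    intro i x
    induction i with
    | zero => simp
    | succ i ih =>
      rw [Function.iterate_succ_apply']
      have := dist_triangle (pt x) (pt (F.par^[i] x)) (pt (F.par (F.par^[i] x)))
      have := hpt (F.par^[i] x)
      push_cast
      linarith
  obtain ⟨i, j, hij, he⟩ := hc
  have h1 := key i c
  have h2 := key j y
  rw [← he, dist_comm] at h2
  have h3 := dist_triangle (pt c) (pt (F.par^[i] c)) (pt y)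
  have h0 : 0 ≤ h := dist_nonneg.trans (hpt c)
  have h4 : ((i + j : ℕ) : ℝ) * h ≤ r * h :=
    mul_le_mul_of_nonneg_right (by exact_mod_cast hij) h0
  push_cast at h4
  linarith

open Classical in
/-- Slots `0, …, k - 1` are assigned to the members of a multiset of labelled radii, a block of `h`
slots being available for each radius. -/
theorem exists_slots {N : Type*} [Nonempty N] {B : Multiset (N × ℕ)} {m h k : ℕ}
    (hm : ∀ q ∈ B, q.2 < m) (hB : ∀ j < m, (B.map Prod.snd).count j ≤ h)
    (hk : (m + 1) * h ≤ k) :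
    ∃ c : Fin k → N, ∀ q ∈ B, ∃ i : Fin k, c i = q.1 ∧ (q.2 + 1) * h ≤ i := by
  let l : ℕ → List N := fun j => ((B.filter (·.2 = j)).map Prod.fst).toList
  have hl : ∀ j < m, (l j).length ≤ h := by
    intro j hj
    refine le_trans (le_of_eq ?_) (hB j hj)
    rw [Multiset.length_toList, Multiset.card_map, Multiset.count_map]
    simp only [eq_comm]
  -- Block `j + 1` of `h` slots serves radius `j`; block 0 is too small for any ball. Unused slots
  -- get an arbitrary centre.
  refine ⟨fun i => ((l (i / h - 1))[i % h]?).getD (Classical.arbitrary N), ?_⟩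
  rintro ⟨x, j⟩ hq
  have hj := hm _ hq
  simp only at hj
  have hx : x ∈ l j := by
    rw [Multiset.mem_toList, Multiset.mem_map]
    exact ⟨(x, j), Multiset.mem_filter.2 ⟨hq, rfl⟩, rfl⟩
  obtain ⟨t, ht, hxt⟩ := List.mem_iff_getElem.1 hx
  have hth : t < h := ht.trans_le (hl j hj)
  have hjm : (j + 2) * h ≤ (m + 1) * h := Nat.mul_le_mul_right h (by omega)
  have hi : (j + 1) * h + t < k := by
    rw [show (j + 2) * h = (j + 1) * h + h by ring] at hjm
    omega
  refine ⟨⟨(j + 1) * h + t, hi⟩, ?_, Nat.le_add_right _ _⟩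
  have h1 : ((j + 1) * h + t) / h = j + 1 := by
    rw [mul_comm, Nat.mul_add_div (by omega), Nat.div_eq_of_lt hth, add_zero]
  have h2 : ((j + 1) * h + t) % h = t := by
    rw [mul_comm, Nat.mul_add_mod, Nat.mod_eq_of_lt hth]
  simp only [h1, h2, Nat.add_sub_cancel]
  rw [List.getElem?_eq_getElem ht, Option.getD_some, hxt]

/-- The loss 8δ in `L` outweighs the factors 1+δ, leaving A·L ≤ (1-δ)(h+1)²; the remaining δh²
absorbs the terms linear in `h`. -/
theorem count_bound {δ m A C L k h n : ℝ} (hδ : 0 < δ) (hδ' : δ ≤ 1 / 16) (hm : 0 < m)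
    (hm' : (m + 1) ^ 2 ≤ (1 + δ) * m ^ 2) (hA : A = (1 + δ) / ((1 - δ) * m ^ 2))
    (hL : L ≤ (1 - 8 * δ) * k ^ 2) (hk0 : 0 ≤ k) (hk : k ≤ (m + 1) * (h + 1)) (hh : 1 ≤ h)
    (hh' : 3 + A + C ≤ δ * h) (hn : h * n ≤ L + h) : A * n + C ≤ h := by
  have hA0 : 0 < A := by
    rw [hA]
    have : 0 < 1 - δ := by linarith
    positivity
  have h1 : k ^ 2 ≤ (1 + δ) * m ^ 2 * (h + 1) ^ 2 := by
    calc k ^ 2 ≤ ((m + 1) * (h + 1)) ^ 2 := pow_le_pow_left₀ hk0 hk 2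
      _ = (m + 1) ^ 2 * (h + 1) ^ 2 := by ring
      _ ≤ _ := by gcongr
  have hAm : A * m ^ 2 * (1 - δ) = 1 + δ := by
    rw [hA]
    have : 1 - δ ≠ 0 := by linarith
    field_simp
  have h3 : (1 - 8 * δ) * (1 + δ) * (A * m ^ 2) ≤ 1 - δ := by
    have h4 : 0 < 1 - δ := by linarith
    refine le_of_mul_le_mul_right ?_ h4
    rw [mul_assoc, hAm]
    nlinarith [pow_pos hδ 2, pow_pos hδ 3]
  have h5 : A * L ≤ (1 - δ) * (h + 1) ^ 2 := by
    calc A * L ≤ A * ((1 - 8 * δ) * ((1 + δ) * m ^ 2 * (h + 1) ^ 2)) := by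
          refine mul_le_mul_of_nonneg_left (hL.trans ?_) hA0.le
          exact mul_le_mul_of_nonneg_left h1 (by linarith)
      _ = (1 - 8 * δ) * (1 + δ) * (A * m ^ 2) * (h + 1) ^ 2 := by ring
      _ ≤ _ := by gcongr
  have h6 := mul_le_mul_of_nonneg_left hn hA0.le
  have h7 := mul_le_mul_of_nonneg_right hh' (zero_le_one.trans hh)
  refine le_of_mul_le_mul_left ?_ (zero_lt_one.trans_le hh)
  nlinarith

theorem exists_nat_parameter {δ : ℝ} (hδ : 0 < δ) :
    ∃ m : ℕ, 0 < m ∧ 16 ≤ δ ^ 3 * (m : ℝ) ^ 2 ∧ ((m : ℝ) + 1) ^ 2 ≤ (1 + δ) * (m : ℝ) ^ 2 := by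
  obtain ⟨m, hm⟩ := exists_nat_gt (max 1 (max (16 / δ ^ 3) (3 / δ)))
  rw [max_lt_iff, max_lt_iff, div_lt_iff₀ (by positivity), div_lt_iff₀ hδ] at hm
  obtain ⟨h1, h2, h3⟩ := hm
  refine ⟨m, by exact_mod_cast zero_lt_one.trans h1, ?_, by nlinarith⟩
  have : (m : ℝ) ≤ (m : ℝ) ^ 2 := by nlinarith
  calc (16 : ℝ) ≤ m * δ ^ 3 := h2.le
    _ = δ ^ 3 * m := mul_comm _ _
    _ ≤ _ := by gcongr

theorem mainTheorem3 (ε : ℝ) (hε : 0 < ε) :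
    ∃ K : ℕ, ∀ k : ℕ, K ≤ k → ∀ (V : Type*) [Finite V] (T : MetricTree V),
      T.length ≤ (1 - ε) * (k : ℝ) ^ 2 →
        T.IsCover (fun i : Fin k => ((i : ℕ) : ℝ≥0) + 1) := by
  obtain ⟨δ, hδ, hδ', hδε⟩ : ∃ δ : ℝ, 0 < δ ∧ δ ≤ 1 / 16 ∧ 8 * δ ≤ ε := by
    refine ⟨min ε (1 / 2) / 8, by positivity, ?_, ?_⟩
    · linarith [min_le_right ε (1 / 2)]
    · linarith [min_le_left ε (1 / 2)]
  obtain ⟨m, hm, hm16, hm'⟩ := exists_nat_parameter hδ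
  -- `H` depends on ε only and makes the additive error of the counts at most δh once h ≥ H.
  obtain ⟨H, hH⟩ := exists_nat_ge ((3 + (1 + δ) / ((1 - δ) * (m : ℝ) ^ 2) +
    (1 + Real.log m * (3 + 8 * m) / δ)) / δ)
  rw [div_le_iff₀ hδ] at hH
  refine ⟨(m + 1) * (H + 1), fun k hk V _ T hT => ?_⟩
  obtain ⟨h, hh, hh1, hh2⟩ : ∃ h : ℕ, H + 1 ≤ h ∧ (m + 1) * h ≤ k ∧ k < (m + 1) * (h + 1) :=
    ⟨k / (m + 1), (Nat.le_div_iff_mul_le m.succ_pos).2 (by linarith), Nat.mul_div_le _ _,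
      Nat.lt_mul_div_succ _ m.succ_pos⟩
  have hh0 : (1 : ℝ) ≤ h := by exact_mod_cast le_trans (Nat.le_add_left 1 H) hh
  have hHh : (H : ℝ) ≤ h := by exact_mod_cast le_trans (Nat.le_add_right H 1) hh
  obtain ⟨ι, _, F, pt, hcard, hpar, hnear⟩ := T.exists_levelTree (zero_lt_one.trans_le hh0)
  obtain ⟨B, hBm, hBcov, hBcount⟩ := F.exists_cover hδ (by linarith) hm16
  obtain ⟨c, hc⟩ := exists_slots hBm (h := h) (k := k) (fun j hj => by
    have := (hBcount j hj).trans (count_bound hδ hδ' (by exact_mod_cast hm) hm' rfl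
      (hT.trans (mul_le_mul_of_nonneg_right (by linarith) (by positivity))) k.cast_nonneg
      (by exact_mod_cast hh2.le) hh0
      (by nlinarith) hcard)
    exact_mod_cast this) hh1
  refine ⟨fun i => pt (c i), Set.eq_univ_of_forall fun q => ?_⟩
  obtain ⟨y, hy⟩ := hnear q
  obtain ⟨b, hb, hby⟩ := hBcov y
  obtain ⟨i, hi, hbi⟩ := hc b hb
  -- One `h` pays for moving `q` to a node and `b.2 * h` for the discrete ball; together they are at
  -- most `i`, below the radius `i + 1`.
  refine Set.mem_iUnion.2 ⟨i, Metric.mem_closedBall.2 ?_⟩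
  have h1 := hby.dist_le hpar
  rw [dist_comm, ← hi] at h1
  have h2 := dist_triangle q (pt y) (pt (c i))
  have h3 : ((b.2 : ℝ) + 1) * h ≤ (i : ℕ) := by exact_mod_cast hbi
  push_cast
  linarith
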